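/- A multigraph $G$ (undirected, with loops and parallel edges allowed; a loop contributes $2$ to the degree of its vertex) with vertex set $V(G)\subseteq\mathbb N$ is \emph{highly computable} if it is locally finite, $V(G)$ is decidable, and both the function $(u,v)\mapsto E(G)(u,v)$, the number of edges joining $u$ to $v$, and the degree function $v\mapsto\deg_G(v)$ are computable. An \emph{index} of $G$ is (a code for) a triple of programs computing the characteristic function of $V(G)$, the function $E(G)(\cdot,\cdot)$ and the function $\deg_G$ (the last two with value $0$ outside $V(G)$). A sequence $(G_n)_{n\in\mathbb N}$ is \emph{uniformly highly computable} if every $G_n$ is locally finite and $V(G_n)$, $E(G_n)(u,v)$ and $\deg_{G_n}(v)$ are computable uniformly in $n$. A \emph{two-way Eulerian path} of $G$ is a bi-infinite sequence of vertices $(w_i)_{i\in\mathbb Z}$ together with edges $\varepsilon_i$ joining $w_i$ to $w_{i+1}$ $(i\in\mathbb Z)$ such that every edge of $G$ equals $\varepsilon_i$ for exactly one $i\in\mathbb Z$. A set $A\subseteq\mathbb N$ is $\Pi^0_2$ if there is a computable relation $R\subseteq\mathbb N^3$ with $x\notin A\iff\exists y\,\forall z\,R(x,y,z)$; it is $\Pi^0_2$-complete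 if moreover every $\Pi^0_2$ set is many-one reducible to $A$. \textbf{Theorem.} The problem of deciding whether a (connected) highly computable multigraph admits a two-way Eulerian path is $\Pi^0_2$-complete. That is: \begin{enumerate} \item the set of all indices of connected highly computable multigraphs that admit a two-way Eulerian path is $\Pi^0_2$-complete; \item hardness does not come from the recognition of indices: there is a uniformly highly computable sequence $(G_n)_{n\in\mathbb N}$ of connected infinite multigraphs such that $\{n\in\mathbb N : G_n\text{ admits a two-way Eulerian path}\}$ is $\Pi^0_2$-complete. \end{enumerate} -/

import Mathlib

noncomputable section

namespace EulerPaths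

/-! ## The second level of the arithmetical hierarchy -/

/-- `A` is `Σ⁰₂`: there is a computable relation `R ⊆ ℕ³` with `x ∈ A ↔ ∃ y, ∀ z, R x y z`. -/
def IsSigma02 (A : Set ℕ) : Prop :=
  ∃ R : ℕ → ℕ → ℕ → Prop,
    ComputablePred (fun p : ℕ × ℕ × ℕ => R p.1 p.2.1 p.2.2) ∧
      ∀ x, x ∈ A ↔ ∃ y, ∀ z, R x y z

/-- `A` is `Π⁰₂`: its complement is `Σ⁰₂`. -/
def IsPi02 (A : Set ℕ) : Prop := IsSigma02 Aᶜ

/-- `A` is `Π⁰₂`-complete: it is `Π⁰₂` and every `Π⁰₂` set is many-one reducible to it. -/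
def IsPi02Complete (A : Set ℕ) : Prop :=
  IsPi02 A ∧ ∀ X : Set ℕ, IsPi02 X → ManyOneReducible (fun n => n ∈ X) (fun n => n ∈ A)

/-! ## Multigraphs

A multigraph is a term of `Graph ℕ ℕ`: its vertices are natural numbers, its edges carry labels in
`ℕ`, and loops and parallel edges are allowed. Every locally finite multigraph with vertex set
contained in `ℕ` has countably many edges, so it is of this form up to naming its edges. -/

/-- Every vertex is incident to only finitely many edges. -/
def IsLocallyFinite (G : Graph ℕ ℕ) : Prop :=
  ∀ v ∈ G.vertexSet, {e | G.Inc e v}.Finite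

/-- The number of edges that join `u` to `v`
(meaningful for locally finite `G`; it is `0` unless `u` and `v` are vertices). -/
def edgeMultiplicity (G : Graph ℕ ℕ) (u v : ℕ) : ℕ := {e | G.IsLink e u v}.ncard

/-- The degree of `v`: the number of edges incident to `v`, where loops are counted twice
(meaningful for locally finite `G`; it is `0` if `v` is not a vertex). -/
def degree (G : Graph ℕ ℕ) (v : ℕ) : ℕ :=
  {e | G.IsNonloopAt e v}.ncard + 2 * {e | G.IsLoopAt e v}.ncard

/-- `G` has a vertex, and any two vertices are joined by a finite path. -/
def Connected (G : Graph ℕ ℕ) : Prop :=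
  G.vertexSet.Nonempty ∧
    ∀ u ∈ G.vertexSet, ∀ v ∈ G.vertexSet, Relation.ReflTransGen G.Adj u v

/-- `G` admits a two-way infinite Eulerian path: a bi-infinite sequence of vertices
`… w (-1), w 0, w 1, …` and edges `ε i` joining `w i` to `w (i + 1)`
such that every edge of `G` is traversed exactly once. -/
def HasTwoWayEulerianPath (G : Graph ℕ ℕ) : Prop :=
  ∃ (w : ℤ → ℕ) (ε : ℤ → ℕ),
    (∀ i, G.IsLink (ε i) (w i) (w (i + 1))) ∧ Set.BijOn ε Set.univ G.edgeSet

/-! ## Highly computable multigraphs -/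

/-- The value of the `e`-th partial computable function at `n`. -/
def phi (e n : ℕ) : Part ℕ := (Denumerable.ofNat Nat.Partrec.Code e).eval n

open Classical in
/-- `e = ⟨a, b, c⟩` is an index (a description) of the highly computable multigraph `G`:
`G` is locally finite, the `a`-th program computes the characteristic function of the vertex set,
the `b`-th program computes the number of edges between two given vertices, and the `c`-th program
computes the degree. As the vertex set is decidable, there is no loss in letting the last two
programs be total, with value `0` outside the vertex set. -/
def IsIndex (e : ℕ) (G : Graph ℕ ℕ) : Prop :=
  IsLocallyFinite G ∧
  (∀ v, phi e.unpair.1 v = Part.some (if v ∈ G.vertexSet then 1 else 0)) ∧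
  (∀ u v, phi e.unpair.2.unpair.1 (Nat.pair u v) = Part.some (edgeMultiplicity G u v)) ∧
  (∀ v, phi e.unpair.2.unpair.2 v = Part.some (degree G v))

/-- A uniformly highly computable sequence of (locally finite) multigraphs: vertex sets, edge
multiplicities and degrees are computable, uniformly in the index of the sequence. -/
def UniformlyHighlyComputable (G : ℕ → Graph ℕ ℕ) : Prop :=
  (∀ n, IsLocallyFinite (G n)) ∧
  ComputablePred (fun p : ℕ × ℕ => p.2 ∈ (G p.1).vertexSet) ∧
  Computable (fun p : ℕ × ℕ × ℕ => edgeMultiplicity (G p.1) p.2.1 p.2.2) ∧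
  Computable (fun p : ℕ × ℕ => degree (G p.1) p.2)

/-- The decision problem: the set of all indices of connected highly computable multigraphs
that admit a two-way infinite Eulerian path. -/
def TwoWayEulerianProblem : Set ℕ :=
  {e | ∃ G : Graph ℕ ℕ, IsIndex e G ∧ Connected G ∧ HasTwoWayEulerianPath G}

end EulerPaths

end

/-! Call a finite trail extendable if both of its ends have unused edges and each of its vertices
either has all its edges in the trail or is reached from an end through unused edges. A locally
finite multigraph has a two-way Eulerian path iff every finite edge set lies in an extendable trail
(`hasTwoWayEulerianPath_iff`). Long segments of an Eulerian path are extendable, because the two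
remaining tails start at their ends. Conversely (`IsDoubleTrail.extend`), let `P` be the edge set of
an extendable trail with ends `a`, `b`, and `Q ⊇ P` that of a much larger one with ends `a'`, `b'`.
Join `a` to `b` by a virtual edge `m`. Then `Q \ P` together with `m` is connected and has boundary
`a' + b'` modulo two, so it has an Eulerian trail (`exists_eulerian_trail`). Cutting this trail at
`m` gives two trails that prolong `P` at both ends and use up `Q`. Iteration yields the bi-infinite
path.

In a highly computable multigraph the degree tells when all neighbours of a vertex have been found,
so extendability of a coded trail is semidecidable, and "for every `N` some extendable trail covers
the edges below `N`" is `Π⁰₂`. Totality of the programs, consistency of their values, local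
finiteness and connectedness have the same form, whence `isPi02_twoWayEulerianProblem`.

Hardness comes from ladders: two rays with doubled edges, and doubled rungs at the positions in `R`.
If `R` is infinite, the part up to a rung is an Eulerian circuit, and a later rung connects its two
boundary vertices on the outside. If `R` is finite, a trail that has used all rungs has changed rays
an even number of times; both its ends lie on one ray, and the rest of the other ray is out of
reach. So an Eulerian path exists iff `R` is infinite (`hasTwoWayEulerianPath_ladder_iff`). Every
`Π⁰₂` set reduces to totality of programs, and `rungs e` is decidable uniformly in `e` and infinite
exactly when the program `e` is total. -/

namespace EulerPaths

/-! ## Finite Eulerian trails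

Edges are elements of a type `E`; the ends of `e` are `s e` and `t e`. -/

section Trails

variable {E V : Type*}

/-- The edge `e` joins `x` to `y`. -/
def Joins (s t : E → V) (e : E) (x y : V) : Prop :=
  (s e = x ∧ t e = y) ∨ (s e = y ∧ t e = x)

/-- The list `l` of pairs (edge, next vertex) is a walk from `x` to `y`. -/
def IsWalk (s t : E → V) : V → List (E × V) → V → Prop
  | x, [], y => x = y
  | x, p :: l, y => Joins s t p.1 x p.2 ∧ IsWalk s t p.2 l y

/-- Adjacency through an edge of the set `S`. -/
def AdjIn (s t : E → V) (S : Set E) (x y : V) : Prop := ∃ e ∈ S, Joins s t e x y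

/-- The edges of a walk. -/
def edges (l : List (E × V)) : List E := l.map Prod.fst

variable {s t : E → V}

@[simp] lemma edges_nil : edges ([] : List (E × V)) = [] := rfl
@[simp] lemma edges_cons (p : E × V) (l : List (E × V)) : edges (p :: l) = p.1 :: edges l := rfl
@[simp] lemma edges_append (l m : List (E × V)) : edges (l ++ m) = edges l ++ edges m := by
  simp [edges]
@[simp] lemma length_edges (l : List (E × V)) : (edges l).length = l.length := by
  simp [edges]

lemma Joins.symm {e : E} {x y : V} (h : Joins s t e x y) : Joins s t e y x := Or.symm h

lemma joins_ends (e : E) : Joins s t e (s e) (t e) := Or.inl ⟨rfl, rfl⟩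

lemma AdjIn.symm {S : Set E} {x y : V} (h : AdjIn s t S x y) : AdjIn s t S y x := by
  obtain ⟨e, he, h⟩ := h
  exact ⟨e, he, h.symm⟩

lemma AdjIn.mono {S T : Set E} (hST : S ⊆ T) {x y : V} (h : AdjIn s t S x y) : AdjIn s t T x y := by
  obtain ⟨e, he, h⟩ := h
  exact ⟨e, hST he, h⟩

/-- Reachability through edges of the set `S`. -/
abbrev ReachIn (s t : E → V) (S : Set E) : V → V → Prop := Relation.ReflTransGen (AdjIn s t S)

lemma ReachIn.symm {S : Set E} {x y : V} (h : ReachIn s t S x y) : ReachIn s t S y x :=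
  have : Std.Symm (AdjIn s t S) := ⟨fun _ _ => AdjIn.symm⟩
  Relation.ReflTransGen.stdSymm.symm _ _ h

lemma ReachIn.mono {S T : Set E} (hST : S ⊆ T) {x y : V} (h : ReachIn s t S x y) :
    ReachIn s t T x y :=
  Relation.ReflTransGen.mono (fun _ _ => AdjIn.mono hST) _ _ h

lemma ReachIn.exists_finset {S : Set E} {x y : V} (h : ReachIn s t S x y) :
    ∃ F : Finset E, (F : Set E) ⊆ S ∧ ReachIn s t F x y := by
  classical
  induction h with
  | refl => exact ⟨∅, by simp, .refl⟩
  | tail _ h ih =>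
    obtain ⟨F, hF, hr⟩ := ih
    obtain ⟨e, he, hj⟩ := h
    refine ⟨insert e F, by simpa [Set.insert_subset_iff] using ⟨he, hF⟩, ?_⟩
    exact (hr.mono (by simp)).tail ⟨e, by simp, hj⟩

lemma isWalk_append {x y : V} {l m : List (E × V)} :
    IsWalk s t x (l ++ m) y ↔ ∃ z, IsWalk s t x l z ∧ IsWalk s t z m y := by
  induction l generalizing x with
  | nil => simp [IsWalk]
  | cons p l ih => simp [IsWalk, ih, and_assoc]

lemma IsWalk.reverse {x y : V} {l : List (E × V)} (h : IsWalk s t x l y) :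
    ∃ m, IsWalk s t y m x ∧ edges m = (edges l).reverse := by
  induction l generalizing x with
  | nil => exact ⟨[], h.symm, rfl⟩
  | cons p l ih =>
    obtain ⟨m, hm, he⟩ := ih h.2
    exact ⟨m ++ [(p.1, x)], isWalk_append.2 ⟨_, hm, h.1.symm, rfl⟩, by simp [he]⟩

lemma IsWalk.congr {s' t' : E → V} {x y : V} {l : List (E × V)} (h : IsWalk s t x l y)
    (hl : ∀ e ∈ edges l, s e = s' e ∧ t e = t' e) : IsWalk s' t' x l y := by
  induction l generalizing x with
  | nil => exact h
  | cons p l ih =>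
    have hp := hl p.1 (by simp)
    refine ⟨?_, ih h.2 fun e he => hl e (by simp [he])⟩
    simpa [Joins, hp.1, hp.2] using h.1

lemma IsWalk.reachIn {x y : V} {l : List (E × V)} (h : IsWalk s t x l y) {S : Set E}
    (hl : ∀ e ∈ edges l, e ∈ S) {e : E} (he : e ∈ edges l) {u v : V} (huv : Joins s t e u v) :
    ReachIn s t S x u := by
  induction l generalizing x with
  | nil => simp at he
  | cons p l ih =>
    have hp : AdjIn s t S x p.2 := ⟨p.1, hl _ (by simp), h.1⟩
    simp only [edges_cons, List.mem_cons] at he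
    by_cases hel : e ∈ edges l
    · exact .head hp (ih h.2 (fun f hf => hl f (by simp [hf])) hel)
    · obtain rfl : e = p.1 := by tauto
      have hx : u = x ∨ u = p.2 := by
        have := h.1
        unfold Joins at this huv
        rcases this with ⟨rfl, h2⟩ | ⟨h1, rfl⟩ <;> rcases huv with ⟨h3, h4⟩ | ⟨h3, h4⟩ <;> simp_all
      rcases hx with rfl | rfl
      · exact .refl
      · exact .single hp

/-- A walk can be split at any end of one of its edges. -/
lemma IsWalk.split {x y : V} {l : List (E × V)} (h : IsWalk s t x l y) {e : E} (he : e ∈ edges l)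
    {u v : V} (huv : Joins s t e u v) :
    ∃ l₁ l₂, l = l₁ ++ l₂ ∧ IsWalk s t x l₁ u ∧ IsWalk s t u l₂ y := by
  induction l generalizing x with
  | nil => simp at he
  | cons p l ih =>
    simp only [edges_cons, List.mem_cons] at he
    by_cases hel : e ∈ edges l
    · obtain ⟨l₁, l₂, rfl, h₁, h₂⟩ := ih h.2 hel
      exact ⟨p :: l₁, l₂, rfl, ⟨h.1, h₁⟩, h₂⟩
    · obtain rfl : e = p.1 := by tauto
      have hx : u = x ∨ u = p.2 := by
        have := h.1
        unfold Joins at this huv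
        rcases this with ⟨rfl, h2⟩ | ⟨h1, rfl⟩ <;> rcases huv with ⟨h3, h4⟩ | ⟨h3, h4⟩ <;> simp_all
      rcases hx with rfl | rfl
      · exact ⟨[], _, rfl, rfl, h⟩
      · exact ⟨[p], l, rfl, ⟨h.1, rfl⟩, h.2⟩

lemma pi_add_self (f : V → ZMod 2) : f + f = 0 := by
  ext v; exact CharTwo.add_self_eq_zero _

variable [DecidableEq V]

/-- The boundary of an edge modulo two. -/
def boundary (s t : E → V) (e : E) : V → ZMod 2 := Pi.single (s e) 1 + Pi.single (t e) 1

lemma Joins.boundary {e : E} {x y : V} (h : Joins s t e x y) :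
    boundary s t e = Pi.single x 1 + Pi.single y 1 := by
  rcases h with ⟨rfl, rfl⟩ | ⟨rfl, rfl⟩
  · rfl
  · exact add_comm _ _

lemma IsWalk.sum_boundary {x y : V} {l : List (E × V)} (h : IsWalk s t x l y) :
    ((edges l).map (boundary s t)).sum = Pi.single x 1 + Pi.single y 1 := by
  induction l generalizing x with
  | nil => obtain rfl : x = y := h; simp [pi_add_self]
  | cons p l ih =>
    simp only [edges_cons, List.map_cons, List.sum_cons, ih h.2, h.1.boundary]
    rw [add_assoc, ← add_assoc (Pi.single p.2 1), pi_add_self, zero_add]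

variable [DecidableEq E]

lemma IsWalk.sum_boundary_toFinset {x y : V} {l : List (E × V)} (h : IsWalk s t x l y)
    (hl : (edges l).Nodup) :
    ∑ e ∈ (edges l).toFinset, boundary s t e = Pi.single x 1 + Pi.single y 1 := by
  rw [List.sum_toFinset _ hl, h.sum_boundary]

/-- A finite edge set with boundary `{x, y}` contains a trail from `x` to `y`. -/
lemma exists_trail (S : Finset E) (x y : V)
    (h : ∑ e ∈ S, boundary s t e = Pi.single x 1 + Pi.single y 1) :
    ∃ l, IsWalk s t x l y ∧ (edges l).Nodup ∧ ∀ e ∈ edges l, e ∈ S := by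
  induction hn : S.card generalizing S x with
  | zero =>
    obtain rfl := Finset.card_eq_zero.1 hn
    have hxy : x = y := by
      by_contra hxy
      simpa [hxy] using congrFun h x
    exact ⟨[], hxy, by simp, by simp⟩
  | succ n ih =>
    by_cases hxy : x = y
    · exact ⟨[], hxy, by simp, by simp⟩
    -- As `x ≠ y`, the boundary of `S` is odd at `x`, so some edge `e` of `S` is odd there. Removing
    -- it moves one end of the boundary from `x` to the other end `z` of `e`.
    have hx := congrFun h x
    rw [Finset.sum_apply] at hx
    obtain ⟨e, heS, he⟩ : ∃ e ∈ S, boundary s t e x ≠ 0 := by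
      apply Finset.exists_ne_zero_of_sum_ne_zero
      rw [hx]; simp [hxy]
    obtain ⟨z, hz⟩ : ∃ z, Joins s t e x z := by
      by_cases h1 : s e = x
      · exact ⟨t e, Or.inl ⟨h1, rfl⟩⟩
      by_cases h2 : t e = x
      · exact ⟨s e, Or.inr ⟨rfl, h2⟩⟩
      · simp [boundary, Ne.symm h1, Ne.symm h2] at he
    obtain ⟨l, hl, hnd, hlS⟩ := ih (S.erase e) z (by
      have := Finset.add_sum_erase S (boundary s t) heS
      rw [h, hz.boundary] at this
      have h2 := congrArg (Pi.single x (1 : ZMod 2) + ·) this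
      simp only [← add_assoc, pi_add_self, zero_add] at h2
      rw [← h2, ← add_assoc, pi_add_self, zero_add]) (by rw [Finset.card_erase_of_mem heS, hn]; rfl)
    refine ⟨(e, z) :: l, ⟨hz, hl⟩, ?_, ?_⟩
    · simp only [edges_cons, List.nodup_cons]
      exact ⟨fun h => by simpa using hlS e h, hnd⟩
    · simp only [edges_cons, List.mem_cons]
      rintro f (rfl | hf)
      · exact heS
      · exact Finset.mem_of_mem_erase (hlS f hf)

/-- A connected finite edge set with boundary `{x, y}` is traversed by a trail from `x` to `y`. -/
theorem exists_eulerian_trail (S : Finset E) (x y : V)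
    (h : ∑ e ∈ S, boundary s t e = Pi.single x 1 + Pi.single y 1)
    (hc : ∀ e ∈ S, ReachIn s t S x (s e)) :
    ∃ l, IsWalk s t x l y ∧ (edges l).Nodup ∧ ∀ e, e ∈ edges l ↔ e ∈ S := by
  -- Take a trail that misses the fewest edges of `S`. If it missed any, a closed detour could be
  -- spliced in.
  let P : ℕ → Prop := fun n => ∃ l, IsWalk s t x l y ∧ (edges l).Nodup ∧
    (∀ e ∈ edges l, e ∈ S) ∧ S.card - (edges l).length = n
  have hP : ∃ n, P n := by
    obtain ⟨l, h1, h2, h3⟩ := exists_trail S x y h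
    exact ⟨_, l, h1, h2, h3, rfl⟩
  classical
  obtain ⟨l, hl, hnd, hlS, hlen⟩ := Nat.find_spec hP
  refine ⟨l, hl, hnd, fun e => ⟨hlS e, fun heS => ?_⟩⟩
  by_contra hel
  -- an unused edge at a vertex of the trail
  obtain ⟨u, v, f, hfS, hfl, huv, l₁, l₂, rfl, h₁, h₂⟩ : ∃ u v f, f ∈ S ∧ f ∉ edges l ∧
      Joins s t f u v ∧ ∃ l₁ l₂, l = l₁ ++ l₂ ∧ IsWalk s t x l₁ u ∧ IsWalk s t u l₂ y := by
    have key : ∀ w, ReachIn s t S x w →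
        (∃ l₁ l₂, l = l₁ ++ l₂ ∧ IsWalk s t x l₁ w ∧ IsWalk s t w l₂ y) ∨
        ∃ u v f, f ∈ S ∧ f ∉ edges l ∧ Joins s t f u v ∧
          ∃ l₁ l₂, l = l₁ ++ l₂ ∧ IsWalk s t x l₁ u ∧ IsWalk s t u l₂ y := by
      intro w hw
      induction hw with
      | refl => exact Or.inl ⟨[], l, rfl, rfl, hl⟩
      | tail _ hadj ih =>
        rcases ih with ih | ih
        · obtain ⟨f, hf, hj⟩ := hadj
          by_cases hfl : f ∈ edges l
          · exact Or.inl (hl.split hfl hj.symm)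
          · exact Or.inr ⟨_, _, f, hf, hfl, hj, ih⟩
        · exact Or.inr ih
    rcases key _ (hc e heS) with h | h
    · exact ⟨_, _, e, heS, hel, joins_ends e, h⟩
    · exact h
  set T := (edges (l₁ ++ l₂)).toFinset with hT
  have hTS : T ⊆ S := fun e he => hlS e (by simpa [hT] using he)
  have hfT : f ∈ S \ T := by simp [hT, hfS]; simpa using hfl
  -- The trail and `S` have the same boundary, so the unused edges have boundary zero. Without `f`
  -- they contain a trail from `v` back to `u`, which `f` closes to a detour at `u`.
  have h0 : ∑ e ∈ S \ T, boundary s t e = 0 := by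
    have h1 := Finset.sum_sdiff (f := boundary s t) hTS
    rw [hl.sum_boundary_toFinset hnd, h] at h1
    simpa using h1
  obtain ⟨c, hc, hcnd, hcS⟩ := exists_trail ((S \ T).erase f) v u (by
    have h1 := Finset.add_sum_erase (S \ T) (boundary s t) hfT
    rw [h0, huv.boundary] at h1
    rw [add_comm (Pi.single v _)]
    have h2 := congrArg ((Pi.single u (1 : ZMod 2) + Pi.single v 1) + ·) h1
    simpa only [← add_assoc _ _ (Finset.sum _ _), pi_add_self, zero_add, add_zero] using h2)
  have hcS' : ∀ e ∈ edges c, e ≠ f ∧ e ∈ S ∧ e ∉ edges l₁ ∧ e ∉ edges l₂ := by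
    intro e he
    simpa [hT] using hcS e he
  have hlen' : (edges (l₁ ++ l₂)).length < S.card := by
    rw [← List.toFinset_card_of_nodup hnd]
    exact Finset.card_lt_card ⟨hTS, fun h => by simpa [hT] using h hfS |> fun h' => hfl (by simpa using h')⟩
  refine Nat.find_min hP (m := S.card - (edges ((l₁ ++ (f, v) :: c) ++ l₂)).length) ?_
    ⟨(l₁ ++ (f, v) :: c) ++ l₂, isWalk_append.2 ⟨u, isWalk_append.2 ⟨u, h₁, huv, hc⟩, h₂⟩,
      ?_, ?_, rfl⟩
  · rw [← hlen]
    simp only [edges_append, edges_cons, List.length_append, List.length_cons] at hlen' ⊢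
    omega
  · simp only [edges_append, edges_cons, List.mem_append, not_or] at hfl hnd ⊢
    simp only [List.nodup_append, List.nodup_cons, List.mem_append, List.mem_cons] at hnd ⊢
    refine ⟨⟨hnd.1, ⟨fun h => (hcS' f h).1 rfl, hcnd⟩, ?_⟩, hnd.2.1, ?_⟩
    · rintro a ha b (rfl | hb) rfl
      · exact hfl.1 ha
      · exact (hcS' _ hb).2.2.1 ha
    · rintro a (ha | rfl | ha) b hb rfl
      · exact hnd.2.2 _ ha _ hb rfl
      · exact hfl.2 hb
      · exact (hcS' _ ha).2.2.2 hb
  · intro e he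
    simp only [edges_append, edges_cons, List.mem_append, List.mem_cons] at he
    rcases he with (he | rfl | he) | he
    · exact hlS e (by simp [he])
    · exact hfS
    · exact (hcS' e he).2.1
    · exact hlS e (by simp [he])

end Trails

/-! ### Prolonging a trail at both ends -/

section Extension

variable {E V : Type*} {s t : E → V}

/-- `P` is the edge set of a trail between `a` and `b` that leaves edges of `A` unused at both of
its ends, and such that every vertex of `P` with an unused edge can be reached from `a` or `b`
through unused edges. -/
structure IsExtendable (s t : E → V) (A : Set E) (P : Finset E) (a b : V) : Prop where
  subset : (P : Set E) ⊆ A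
  left : ∃ e ∈ A \ P, ∃ x, Joins s t e a x
  right : ∃ e ∈ A \ P, ∃ x, Joins s t e b x
  reach : ∀ v, (∃ e ∈ P, ∃ x, Joins s t e v x) → (∀ e ∈ A, ∀ x, Joins s t e v x → e ∈ P) ∨
    ReachIn s t (A \ P) a v ∨ ReachIn s t (A \ P) b v

lemma IsExtendable.symm {A : Set E} {P : Finset E} {a b : V} (h : IsExtendable s t A P a b) :
    IsExtendable s t A P b a :=
  ⟨h.subset, h.right, h.left, fun v hv => (h.reach v hv).imp_right Or.symm⟩

/-- Two walks `l` and `r` from `o` which together form an extendable trail with edge set `P`. -/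
structure IsDoubleTrail (s t : E → V) (A : Set E) (o : V) (l r : List (E × V)) (P : Finset E)
    (a b : V) : Prop where
  left : IsWalk s t o l a
  right : IsWalk s t o r b
  nodup : (edges l ++ edges r).Nodup
  mem_iff : ∀ e, e ∈ edges l ++ edges r ↔ e ∈ P
  extendable : IsExtendable s t A P a b

lemma nodup_append_append {l r l' r' : List E} (h : (l ++ r).Nodup) (h' : (l' ++ r').Nodup)
    (hd : ∀ x, x ∈ l' ∨ x ∈ r' → x ∉ l ++ r) : ((l ++ l') ++ (r ++ r')).Nodup := by
  have hp : ((l ++ l') ++ (r ++ r')).Perm ((l ++ r) ++ (l' ++ r')) := by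
    simp only [List.append_assoc]
    refine List.Perm.append_left _ ?_
    simp only [← List.append_assoc]
    exact List.Perm.append_right _ List.perm_append_comm
  rw [hp.nodup_iff, List.nodup_append]
  refine ⟨h, h', ?_⟩
  rintro a ha b hb rfl
  exact hd a (List.mem_append.1 hb) ha

lemma mem_append_append_iff {l r l' r' : List E} {P Q : Finset E} {e : E} (hPQ : P ⊆ Q)
    (h : e ∈ l ++ r ↔ e ∈ P) (h' : e ∈ l' ∨ e ∈ r' ↔ e ∈ Q ∧ e ∉ P) :
    e ∈ (l ++ l') ++ (r ++ r') ↔ e ∈ Q := by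
  have := @hPQ e
  simp only [List.mem_append] at h ⊢
  tauto

variable [DecidableEq E] [DecidableEq V]

lemma IsDoubleTrail.sum_boundary {A : Set E} {o : V} {l r : List (E × V)} {P : Finset E}
    {a b : V} (h : IsDoubleTrail s t A o l r P a b) :
    ∑ e ∈ P, boundary s t e = Pi.single a 1 + Pi.single b 1 := by
  have hP : P = (edges l ++ edges r).toFinset := by
    ext e; rw [List.mem_toFinset, h.mem_iff]
  rw [hP, List.sum_toFinset _ h.nodup, List.map_append, List.sum_append, h.left.sum_boundary,
    h.right.sum_boundary, add_add_add_comm, pi_add_self, zero_add]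

set_option maxHeartbeats 1000000 in
/-- If there are arbitrarily large extendable trails, then every extendable trail can be properly
extended at both ends so as to contain given edges. -/
lemma IsDoubleTrail.extend [Infinite E] {A : Set E}
    (hfin : ∀ v, {e ∈ A | ∃ x, Joins s t e v x}.Finite)
    (hA : ∀ F : Finset E, (F : Set E) ⊆ A → ∃ P a b l, F ⊆ P ∧ IsWalk s t a l b ∧
      (edges l).Nodup ∧ (∀ e, e ∈ edges l ↔ e ∈ P) ∧ IsExtendable s t A P a b)
    {o : V} {l r : List (E × V)} {P : Finset E} {a b : V} (h : IsDoubleTrail s t A o l r P a b)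
    (F : Finset E) (hF : (F : Set E) ⊆ A) :
    ∃ l' r' Q a' b', IsDoubleTrail s t A o (l ++ l') (r ++ r') Q a' b' ∧ l' ≠ [] ∧ r' ≠ [] ∧
      F ⊆ Q := by
  classical
  let VP : Finset V := P.image s ∪ P.image t
  have hVP : ∀ {e x y}, e ∈ P → Joins s t e x y → x ∈ VP := by
    rintro e x y he (⟨rfl, -⟩ | ⟨-, rfl⟩)
    · exact Finset.mem_union_left _ (Finset.mem_image_of_mem _ he)
    · exact Finset.mem_union_right _ (Finset.mem_image_of_mem _ he)
  have hVP' : ∀ v ∈ VP, ∃ e ∈ P, ∃ x, Joins s t e v x := by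
    intro v hv
    simp only [VP, Finset.mem_union, Finset.mem_image] at hv
    rcases hv with ⟨e, he, rfl⟩ | ⟨e, he, rfl⟩
    · exact ⟨e, he, _, joins_ends e⟩
    · exact ⟨e, he, _, (joins_ends e).symm⟩
  -- Finite sets of edges outside `P` that witness reachability. They are put into `Q`, so that
  -- reachability persists within `Q \ P`.
  have hcert : ∀ v, ∃ C : Finset E, (C : Set E) ⊆ A \ P ∧ (v ∈ VP →
      (∀ e ∈ A, ∀ x, Joins s t e v x → e ∈ P) ∨ ReachIn s t C a v ∨ ReachIn s t C b v) := by
    intro v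
    by_cases hv : v ∈ VP
    · rcases h.extendable.reach v (hVP' v hv) with h1 | h1 | h1
      · exact ⟨∅, by simp, fun _ => Or.inl h1⟩
      · obtain ⟨C, hC, hr⟩ := h1.exists_finset
        exact ⟨C, hC, fun _ => Or.inr (Or.inl hr)⟩
      · obtain ⟨C, hC, hr⟩ := h1.exists_finset
        exact ⟨C, hC, fun _ => Or.inr (Or.inr hr)⟩
    · exact ⟨∅, by simp, fun h => absurd h hv⟩
  choose C hCA hC using hcert
  obtain ⟨Q, a', b', w, hQ, hw, hwnd, hwQ, hext⟩ := hA
    (F ∪ P ∪ ({a, b} : Finset V).biUnion (fun v => (hfin v).toFinset) ∪ VP.biUnion C) (by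
      simp only [Finset.coe_union, Finset.coe_biUnion, Set.union_subset_iff, Set.iUnion_subset_iff]
      refine ⟨⟨⟨hF, h.extendable.subset⟩, fun v _ => ?_⟩, fun v _ => (hCA v).trans Set.sdiff_subset⟩
      rw [Set.Finite.coe_toFinset]
      exact Set.sep_subset _ _)
  simp only [Finset.union_subset_iff, Finset.biUnion_subset] at hQ
  obtain ⟨⟨⟨hFQ, hPQ⟩, hIQ⟩, hCQ⟩ := hQ
  have hI : ∀ v ∈ ({a, b} : Finset V), ∀ e ∈ A, ∀ x, Joins s t e v x → e ∈ Q := by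
    intro v hv e he x hx
    exact hIQ v hv ((hfin v).mem_toFinset.2 ⟨he, x, hx⟩)
  -- All edges of `A` at `a` and `b` are in `Q`, while `a'` and `b'` have edges outside `Q`. This
  -- makes both prolongations nonempty.
  have hleft : a' ≠ a ∧ a' ≠ b := by
    obtain ⟨e, ⟨heA, heQ⟩, x, hx⟩ := hext.left
    constructor <;> rintro rfl <;> exact heQ (hI _ (by simp) e heA x hx)
  have hright : b' ≠ a ∧ b' ≠ b := by
    obtain ⟨e, ⟨heA, heQ⟩, x, hx⟩ := hext.right
    constructor <;> rintro rfl <;> exact heQ (hI _ (by simp) e heA x hx)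
  -- The virtual edge from `a` to `b` takes the place of the trail `P`. Its name may be that of a
  -- real edge; this is harmless, since all other edges considered are in `Q`.
  obtain ⟨m, hm⟩ := Infinite.exists_notMem_finset Q
  let s' := Function.update s m a
  let t' := Function.update t m b
  have hst : ∀ e ≠ m, s' e = s e ∧ t' e = t e := fun e he => by simp [s', t', he]
  have hjm : Joins s' t' m a b := Or.inl ⟨by simp [s'], by simp [t']⟩
  have hne : ∀ {e}, e ∈ Q → e ≠ m := by rintro e he rfl; exact hm he
  have hjoins : ∀ {e x y}, e ∈ Q → Joins s t e x y → Joins s' t' e x y := by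
    intro e x y he hj
    simpa [Joins, hst e (hne he)] using hj
  let S : Finset E := insert m (Q \ P)
  have hmD : m ∉ Q \ P := fun h => hm (Finset.mem_sdiff.1 h).1
  have hsum : ∑ e ∈ S, boundary s' t' e = Pi.single a' 1 + Pi.single b' 1 := by
    have h1 : ∑ e ∈ Q \ P, boundary s' t' e = ∑ e ∈ Q \ P, boundary s t e := by
      refine Finset.sum_congr rfl fun e he => ?_
      obtain ⟨h1, h2⟩ := hst e (hne (Finset.mem_sdiff.1 he).1)
      rw [boundary, boundary, h1, h2]
    have h2 := hw.sum_boundary_toFinset hwnd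
    have h3 : (edges w).toFinset = Q := by ext e; rw [List.mem_toFinset, hwQ]
    rw [Finset.sum_insert hmD, hjm.boundary, h1, ← h.sum_boundary, add_comm,
      Finset.sum_sdiff hPQ, ← h3, h2]
  have hab : ReachIn s' t' S a b := .single ⟨m, by simp [S], hjm⟩
  have hsub : ∀ {X : Finset E}, X ⊆ Q → (X : Set E) ⊆ A \ P → ∀ {x y}, ReachIn s t X x y →
      ReachIn s' t' S x y := by
    intro X hXQ hXP x y hr
    refine Relation.ReflTransGen.mono (fun u v => ?_) _ _ hr
    rintro ⟨e, he, hj⟩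
    have := (hXP he).2
    exact ⟨e, by simp [S, hXQ he]; exact Or.inr this, hjoins (hXQ he) hj⟩
  have hVR : ∀ v ∈ VP, (∀ e ∈ A, ∀ x, Joins s t e v x → e ∈ P) ∨ ReachIn s' t' S a v := by
    intro v hv
    rcases hC v hv with h1 | h1 | h1
    · exact Or.inl h1
    · exact Or.inr (hsub (hCQ v hv) (hCA v) h1)
    · exact Or.inr (hab.trans (hsub (hCQ v hv) (hCA v) h1))
  -- Follow a walk in `Q` towards `a`. If the next edge is in `P`, then `z` lies on `P` and
  -- extendability applies. Otherwise the next vertex has an edge outside `P`, so by induction it is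
  -- connected to `a` within `S`.
  have hkey : ∀ z, ReachIn s t Q z a →
      (∀ e ∈ A, ∀ x, Joins s t e z x → e ∈ P) ∨ ReachIn s' t' S z a := by
    intro z hz
    induction hz using Relation.ReflTransGen.head_induction_on with
    | refl => exact Or.inr .refl
    | head hadj _ ih =>
      obtain ⟨f, hfQ, hj⟩ := hadj
      by_cases hfP : f ∈ P
      · exact (hVR _ (hVP hfP hj)).imp_right ReachIn.symm
      · rcases ih with ih | ih
        · exact absurd (ih f (hext.subset hfQ) _ hj.symm) hfP
        · refine Or.inr (.head ⟨f, ?_, hjoins hfQ hj⟩ ih)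
          simpa [S] using Or.inr ⟨hfQ, hfP⟩
  have hwalk : ∀ {e u v}, e ∈ Q → Joins s t e u v → ReachIn s t Q a' u := fun he hj =>
    hw.reachIn (fun f hf => (hwQ f).1 hf) ((hwQ _).2 he) hj
  have ha'a : ReachIn s t Q a' a := by
    obtain ⟨e, ⟨heA, -⟩, x, hx⟩ := h.extendable.left
    exact hwalk (hI a (by simp) e heA x hx) hx
  have hRa' : ReachIn s' t' S a' a := by
    refine (hkey a' ha'a).resolve_left fun hsat => ?_
    obtain ⟨e, ⟨heA, heQ⟩, x, hx⟩ := hext.left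
    exact heQ (hPQ (hsat e heA x hx))
  obtain ⟨T, hT, hTnd, hTS⟩ := exists_eulerian_trail (s := s') (t := t') S a' b' hsum (by
    intro e he
    simp only [S, Finset.mem_insert, Finset.mem_sdiff] at he
    rcases he with rfl | ⟨heQ, heP⟩
    · simpa [s'] using hRa'
    · rw [(hst e (hne heQ)).1]
      refine hRa'.trans (ReachIn.symm ?_)
      refine (hkey _ ((hwalk heQ (joins_ends e)).symm.trans ha'a)).resolve_left fun hsat => ?_
      exact heP (hsat e (hext.subset heQ) _ (joins_ends e)))
  -- Cut the trail at `m` and reverse the first piece. Which piece prolongs the end `a` depends on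
  -- the direction in which `m` is traversed.
  obtain ⟨p, hpT, hpm⟩ := List.mem_map.1 ((hTS m).2 (by simp [S]))
  obtain ⟨T₁, T₂, rfl⟩ := List.append_of_mem hpT
  obtain ⟨z, hT₁, hj, hT₂⟩ := isWalk_append.1 hT
  rw [hpm] at hj
  simp only [edges_append, edges_cons, hpm, List.mem_append, List.mem_cons] at hTS hTnd
  have hm₁ : m ∉ edges T₁ ∧ m ∉ edges T₂ := by
    simp only [List.nodup_append, List.nodup_cons, List.mem_cons] at hTnd
    exact ⟨fun hh => hTnd.2.2 m hh m (Or.inl rfl) rfl, hTnd.2.1.1⟩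
  have hD : ∀ e, e ∈ edges T₁ ∨ e ∈ edges T₂ ↔ e ∈ Q ∧ e ∉ P := by
    intro e
    have := hTS e
    simp only [S, Finset.mem_insert, Finset.mem_sdiff] at this
    by_cases hem : e = m
    · subst hem; simp [hm₁, hm]
    · simpa [hem] using this
  have hT₁' := hT₁.congr fun e he => hst e (fun hem => hm₁.1 (hem ▸ he))
  have hT₂' := hT₂.congr fun e he => hst e (fun hem => hm₁.2 (hem ▸ he))
  obtain ⟨T₁r, hT₁r, hT₁e⟩ := hT₁'.reverse
  have hD' : ∀ e, e ∈ edges T₁r ∨ e ∈ edges T₂ ↔ e ∈ Q ∧ e ∉ P := by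
    intro e; rw [← hD, hT₁e, List.mem_reverse]
  have hnd' : (edges T₁r ++ edges T₂).Nodup := by
    rw [hT₁e]
    simp only [List.nodup_append, List.nodup_cons, List.mem_cons, List.nodup_reverse,
      List.mem_reverse] at hTnd ⊢
    exact ⟨hTnd.1, hTnd.2.1.2, fun x hx y hy => hTnd.2.2 x hx y (Or.inr hy)⟩
  have hlr := h.nodup
  have hmem := h.mem_iff
  have hj' : (z = a ∧ p.2 = b) ∨ (z = b ∧ p.2 = a) := by
    have : s' m = a ∧ t' m = b := by simp [s', t']
    rcases hj with ⟨h1, h2⟩ | ⟨h1, h2⟩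
    · exact Or.inl ⟨h1 ▸ this.1, h2 ▸ this.2⟩
    · exact Or.inr ⟨h2 ▸ this.2, h1 ▸ this.1⟩
  have hnil₁ : T₁r ≠ [] := by
    rintro rfl
    have : z = a' := hT₁r
    rcases hj' with ⟨h1, -⟩ | ⟨h1, -⟩
    · exact hleft.1 (this ▸ h1)
    · exact hleft.2 (this ▸ h1)
  have hnil₂ : T₂ ≠ [] := by
    rintro rfl
    have : p.2 = b' := hT₂
    rcases hj' with ⟨-, h1⟩ | ⟨-, h1⟩
    · exact hright.2 (this ▸ h1)
    · exact hright.1 (this ▸ h1)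
  rcases hj' with ⟨rfl, h2⟩ | ⟨rfl, h2⟩
  · refine ⟨T₁r, T₂, Q, a', b', ⟨isWalk_append.2 ⟨_, h.left, hT₁r⟩,
      isWalk_append.2 ⟨_, h.right, h2 ▸ hT₂'⟩, ?_, ?_, hext⟩, hnil₁, hnil₂, hFQ⟩
    · rw [edges_append, edges_append]
      exact nodup_append_append hlr hnd' fun e he hm => ((hD' e).1 he).2 ((hmem e).1 hm)
    · intro e
      rw [edges_append, edges_append]
      exact mem_append_append_iff hPQ (hmem e) (hD' e)
  · refine ⟨T₂, T₁r, Q, b', a', ⟨isWalk_append.2 ⟨_, h.left, h2 ▸ hT₂'⟩,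
      isWalk_append.2 ⟨_, h.right, hT₁r⟩, ?_, ?_, hext.symm⟩, hnil₂, hnil₁, hFQ⟩
    · rw [edges_append, edges_append]
      exact nodup_append_append hlr (List.nodup_append_comm.1 hnd')
        fun e he hm => ((hD' e).1 he.symm).2 ((hmem e).1 hm)
    · intro e
      rw [edges_append, edges_append]
      exact mem_append_append_iff hPQ (hmem e) (or_comm.trans (hD' e))

end Extension

/-! ### The limit of growing trails -/

section Limit

lemma exists_limit_of_prefixes {α : Type*} (L : ℕ → List α)
    (hL : ∀ n, ∃ m, m ≠ [] ∧ L (n + 1) = L n ++ m) :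
    ∃ g : ℕ → α, ∀ n, n ≤ (L n).length ∧ ∀ i < (L n).length, (L n)[i]? = some (g i) := by
  have hlen : ∀ n, n ≤ (L n).length := by
    intro n
    induction n with
    | zero => simp
    | succ n ih =>
      obtain ⟨m, hm, h⟩ := hL n
      rw [h, List.length_append]
      have := List.length_pos_iff.2 hm
      omega
  have hstep : ∀ n k i, i < (L n).length → (L (n + k))[i]? = (L n)[i]? := by
    intro n k i hi
    have : (L n) <+: L (n + k) := by
      induction k with
      | zero => exact List.prefix_rfl
      | succ k ih =>
        obtain ⟨m, -, h⟩ := hL (n + k)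
        rw [← add_assoc, h]
        exact ih.trans (List.prefix_append _ _)
    obtain ⟨m, hm⟩ := this
    rw [← hm, List.getElem?_append_left hi]
  refine ⟨fun i => (L (i + 1))[i]'(hlen (i + 1)), fun n => ⟨hlen n, fun i hi => ?_⟩⟩
  rw [← List.getElem?_eq_getElem, ← hstep n (i + 1) i hi, ← hstep (i + 1) n i (hlen (i + 1)),
    add_comm]

variable {V : Type*}

/-- The vertices visited by a walk from `o` whose steps are given by `g`. -/
def visited {E : Type*} (o : V) (g : ℕ → E × V) : ℕ → V
  | 0 => o
  | n + 1 => (g n).2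

lemma IsWalk.joins_visited {E : Type*} {s t : E → V} {x y : V} {l : List (E × V)}
    (h : IsWalk s t x l y) (g : ℕ → E × V) (hg : ∀ i < l.length, l[i]? = some (g i)) (i : ℕ)
    (hi : i < l.length) : Joins s t (g i).1 (visited x g i) (visited x g (i + 1)) := by
  induction l generalizing x g i with
  | nil => simp at hi
  | cons p l ih =>
    have h0 : p = g 0 := by simpa using hg 0 (by simp)
    cases i with
    | zero => simpa [visited, ← h0] using h.1
    | succ i =>
      have := ih h.2 (fun j => g (j + 1)) (fun j hj => by simpa using hg (j + 1) (by simpa using hj))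
        i (by simpa using hi)
      cases i with
      | zero => simpa [visited, ← h0] using this
      | succ i => exact this

variable [DecidableEq V]

theorem exists_bi_infinite_trail {s t : ℕ → V} {A : Set ℕ}
    (hfin : ∀ v, {e ∈ A | ∃ x, Joins s t e v x}.Finite)
    (hA : ∀ F : Finset ℕ, (F : Set ℕ) ⊆ A → ∃ P a b l, F ⊆ P ∧ IsWalk s t a l b ∧
      (edges l).Nodup ∧ (∀ e, e ∈ edges l ↔ e ∈ P) ∧ IsExtendable s t A P a b) :
    ∃ (w : ℤ → V) (ε : ℤ → ℕ),
      (∀ i, Joins s t (ε i) (w i) (w (i + 1))) ∧ Set.BijOn ε Set.univ A := by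
  classical
  obtain ⟨P, o, b, l, -, hl, hnd, hlP, hext⟩ := hA ∅ (by simp)
  let St := {q : List (ℕ × V) × List (ℕ × V) //
    ∃ Q a b, IsDoubleTrail s t A o q.1 q.2 Q a b}
  have hstep : ∀ (n : ℕ) (q : St), ∃ q' : St, (∃ m, m ≠ [] ∧ q'.1.1 = q.1.1 ++ m) ∧
      (∃ m, m ≠ [] ∧ q'.1.2 = q.1.2 ++ m) ∧
      ∀ e < n, e ∈ A → e ∈ edges q'.1.1 ++ edges q'.1.2 := by
    rintro n ⟨⟨l, r⟩, Q, a, b, hq⟩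
    obtain ⟨l', r', Q', a', b', hq', hl', hr', hF⟩ :=
      hq.extend hfin hA ((Finset.range n).filter (· ∈ A)) (by intro e; simp)
    exact ⟨⟨(l ++ l', r ++ r'), Q', a', b', hq'⟩, ⟨l', hl', rfl⟩, ⟨r', hr', rfl⟩,
      fun e he heA => (hq'.mem_iff e).2 (hF (by simpa using ⟨he, heA⟩))⟩
  choose next hn₁ hn₂ hn₃ using hstep
  -- The initial trail starts at `o`, so its left half is empty. Stage `n + 1` contains every edge
  -- of `A` below `n`.
  let f : ℕ → St := fun n => Nat.rec
    ⟨([], l), P, o, b, rfl, hl, by simpa using hnd, by simpa using hlP, hext⟩ next n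
  have hf : ∀ n, f (n + 1) = next n (f n) := fun n => rfl
  obtain ⟨gl, hgl⟩ := exists_limit_of_prefixes (fun n => (f n).1.1) fun n => hn₁ n (f n)
  obtain ⟨gr, hgr⟩ := exists_limit_of_prefixes (fun n => (f n).1.2) fun n => hn₂ n (f n)
  have hwl : ∀ i, Joins s t (gl i).1 (visited o gl i) (visited o gl (i + 1)) := by
    intro i
    obtain ⟨Q, a, b, hq⟩ := (f (i + 1)).2
    exact hq.left.joins_visited gl (hgl (i + 1)).2 i (hgl (i + 1)).1
  have hwr : ∀ i, Joins s t (gr i).1 (visited o gr i) (visited o gr (i + 1)) := by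
    intro i
    obtain ⟨Q, a, b, hq⟩ := (f (i + 1)).2
    exact hq.right.joins_visited gr (hgr (i + 1)).2 i (hgr (i + 1)).1
  have hel : ∀ n, ∀ i < n, (edges (f n).1.1)[i]? = some (gl i).1 := by
    intro n i hi
    simp [edges, (hgl n).2 i (hi.trans_le (hgl n).1)]
  have her : ∀ n, ∀ i < n, (edges (f n).1.2)[i]? = some (gr i).1 := by
    intro n i hi
    simp [edges, (hgr n).2 i (hi.trans_le (hgr n).1)]
  have hndl : ∀ n, (edges (f n).1.1 ++ edges (f n).1.2).Nodup := by
    intro n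
    obtain ⟨Q, a, b, hq⟩ := (f n).2
    exact hq.nodup
  -- `Int.negSucc n` is `-(n + 1)`: the edge of `gl n` joins the positions `-(n + 1)` and `-n`, and
  -- is traversed backwards.
  refine ⟨fun i => match i with
      | Int.ofNat n => visited o gr n
      | Int.negSucc n => visited o gl (n + 1),
    fun i => match i with
      | Int.ofNat n => (gr n).1
      | Int.negSucc n => (gl n).1, ?_, ?_, ?_, ?_⟩
  · rintro (n | n)
    · exact hwr n
    · cases n with
      | zero => exact (hwl 0).symm
      | succ n => exact (hwl (n + 1)).symm
  · have hsub : ∀ n, ∀ e ∈ edges (f n).1.1 ++ edges (f n).1.2, e ∈ A := by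
      intro n e he
      obtain ⟨Q, a, b, hq⟩ := (f n).2
      exact hq.extendable.subset ((hq.mem_iff e).1 he)
    rintro (n | n) -
    · exact hsub (n + 1) _ (List.mem_append_right _
        (List.mem_of_getElem? (her (n + 1) n n.lt_succ_self)))
    · exact hsub (n + 1) _ (List.mem_append_left _
        (List.mem_of_getElem? (hel (n + 1) n n.lt_succ_self)))
  · have hcross : ∀ i j, (gl i).1 ≠ (gr j).1 := by
      intro i j h
      have := (List.nodup_append.1 (hndl (i + j + 1))).2.2
      exact this _ (List.mem_of_getElem? (hel (i + j + 1) i (by omega))) _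
        (List.mem_of_getElem? (her (i + j + 1) j (by omega))) h
    have hinj : ∀ (L : ℕ → List ℕ) (g : ℕ → ℕ), (∀ n, (L n).Nodup) →
        (∀ n, ∀ i < n, (L n)[i]? = some (g i)) → Function.Injective g := by
      intro L g hnd hL i j hij
      have h1 := hL (i + j + 1) i (by omega)
      have h2 := hL (i + j + 1) j (by omega)
      have h3 := (List.getElem?_eq_some_iff.1 h1).1
      exact (List.getElem?_inj h3 (hnd _)).1 (by rw [h1, h2, hij])
    have hil := hinj _ _ (fun n => (List.nodup_append.1 (hndl n)).1) hel
    have hir := hinj _ _ (fun n => (List.nodup_append.1 (hndl n)).2.1) her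
    rintro (i | i) - (j | j) - hij
    · exact congrArg _ (hir hij)
    · exact absurd hij.symm (hcross j i)
    · exact absurd hij (hcross i j)
    · exact congrArg _ (hil hij)
  · intro e he
    have := hn₃ (e + 1) (f (e + 1)) e e.lt_succ_self he
    rw [← hf, List.mem_append] at this
    rcases this with h | h
    · obtain ⟨p, hp, rfl⟩ := List.mem_map.1 h
      obtain ⟨i, hi, h⟩ := List.getElem_of_mem hp
      have := (hgl (p.1 + 1 + 1)).2 i hi
      rw [List.getElem?_eq_getElem hi, h] at this
      exact ⟨Int.negSucc i, trivial, by simp [← Option.some.inj this]⟩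
    · obtain ⟨p, hp, rfl⟩ := List.mem_map.1 h
      obtain ⟨i, hi, h⟩ := List.getElem_of_mem hp
      have := (hgr (p.1 + 1 + 1)).2 i hi
      rw [List.getElem?_eq_getElem hi, h] at this
      exact ⟨Int.ofNat i, trivial, by simp [← Option.some.inj this]⟩

end Limit

/-! ## A characterization of Eulerian paths by finite trails -/

/-- Adjacency in `G` through an edge that is not among `ε 0, …, ε (n - 1)`. -/
def AdjAvoiding (G : Graph ℕ ℕ) (n : ℕ) (ε : ℕ → ℕ) (x y : ℕ) : Prop :=
  ∃ e, G.IsLink e x y ∧ ∀ i < n, ε i ≠ e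

/-- The sequences `w` and `ε` describe a trail of length `n` whose two ends have unused edges, and
each vertex of which that has unused edges can be reached from an end through unused edges. -/
structure IsExtendableTrail (G : Graph ℕ ℕ) (n : ℕ) (w ε : ℕ → ℕ) : Prop where
  link : ∀ i < n, G.IsLink (ε i) (w i) (w (i + 1))
  ne : ∀ i < n, ∀ j < i, ε i ≠ ε j
  left : ∃ x, AdjAvoiding G n ε (w 0) x
  right : ∃ x, AdjAvoiding G n ε (w n) x
  reach : ∀ i < n + 1, (∀ e x, G.IsLink e (w i) x → ∃ j < n, ε j = e) ∨
    Relation.ReflTransGen (AdjAvoiding G n ε) (w 0) (w i) ∨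
    Relation.ReflTransGen (AdjAvoiding G n ε) (w n) (w i)

/-- Every finite set of edges is contained in an extendable trail. -/
def HasExtendableTrails (G : Graph ℕ ℕ) : Prop :=
  ∀ N, ∃ n w ε, IsExtendableTrail G n w ε ∧ ∀ e < N, e ∈ G.edgeSet → ∃ i < n, ε i = e

/-- The segment between the positions `-K` and `K` works: an unused edge lies on one of the two
tails, and that tail leads from an end of the segment to the edge through unused edges. -/
lemma HasTwoWayEulerianPath.hasExtendableTrails {G : Graph ℕ ℕ} (h : HasTwoWayEulerianPath G) :
    HasExtendableTrails G := by
  obtain ⟨w, ε, hlink, hbij⟩ := h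
  intro N
  have hinj : ∀ i j, ε i = ε j → i = j := fun i j h => hbij.injOn trivial trivial h
  obtain ⟨K, hK⟩ : ∃ K : ℕ, ∀ e < N, e ∈ G.edgeSet → ∃ i : ℤ, -K ≤ i ∧ i < K ∧ ε i = e := by
    induction N with
    | zero => exact ⟨0, by simp⟩
    | succ N ih =>
      obtain ⟨K, hK⟩ := ih
      by_cases hN : N ∈ G.edgeSet
      · obtain ⟨i, -, hi⟩ := hbij.surjOn hN
        refine ⟨max K (i.natAbs + 1), fun e he heG => ?_⟩
        rcases Nat.lt_succ_iff_lt_or_eq.1 he with he | rfl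
        · obtain ⟨j, h1, h2, h3⟩ := hK e he heG
          exact ⟨j, by omega, by omega, h3⟩
        · exact ⟨i, by omega, by omega, hi⟩
      · refine ⟨K, fun e he heG => ?_⟩
        rcases Nat.lt_succ_iff_lt_or_eq.1 he with he | rfl
        · exact hK e he heG
        · exact absurd heG hN
  have hout : ∀ j : ℤ, j < -K ∨ K ≤ j → ∀ i < 2 * K, ε (i - K : ℤ) ≠ ε j := by
    intro j hj i hi h
    have := hinj _ _ h
    omega
  have hright : ∀ k : ℕ, Relation.ReflTransGen
      (AdjAvoiding G (2 * K) fun i => ε (i - K : ℤ)) (w K) (w (K + k)) := by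
    intro k
    induction k with
    | zero => simpa using .refl
    | succ k ih =>
      refine ih.tail ⟨ε (K + k), ?_, hout _ (by omega)⟩
      have := hlink (K + k)
      push_cast
      rwa [← add_assoc]
  have hleft : ∀ k : ℕ, Relation.ReflTransGen
      (AdjAvoiding G (2 * K) fun i => ε (i - K : ℤ)) (w (-K)) (w (-K - k)) := by
    intro k
    induction k with
    | zero => simpa using .refl
    | succ k ih =>
      refine ih.tail ⟨ε (-K - (k + 1)), ?_, hout _ (by omega)⟩
      have := (hlink (-K - (k + 1))).symm
      push_cast
      rwa [show (-K - (k + 1) + 1 : ℤ) = -K - k by ring] at this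
  have hzero : ((0 : ℕ) : ℤ) - K = -K := by simp
  have htop : ((2 * K : ℕ) : ℤ) - K = K := by push_cast; ring
  refine ⟨2 * K, fun i => w (i - K), fun i => ε (i - K), ⟨?_, ?_, ?_, ?_, ?_⟩, ?_⟩
  · intro i hi
    have := hlink (i - K)
    rwa [show (i - K + 1 : ℤ) = ((i + 1 : ℕ) : ℤ) - K by push_cast; ring] at this
  · intro i hi j hj h
    have := hinj _ _ h
    omega
  · simp only [hzero]
    refine ⟨w (-K - 1), ε (-K - 1), ?_, hout _ (by omega)⟩
    simpa using (hlink (-K - 1)).symm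
  · simp only [htop]
    exact ⟨w (K + 1), ε K, hlink K, hout _ (by omega)⟩
  · intro i hi
    simp only [hzero, htop]
    by_cases hsat : ∀ e x, G.IsLink e (w (i - K)) x → ∃ j < 2 * K, ε (j - K : ℤ) = e
    · exact Or.inl hsat
    push Not at hsat
    obtain ⟨e, x, hex, he⟩ := hsat
    obtain ⟨j, -, rfl⟩ := hbij.surjOn hex.edge_mem
    have hj : j < -K ∨ K ≤ j := by
      by_contra hj
      push Not at hj
      refine he (j + K).toNat (by omega) ?_
      congr 1
      omega
    have hend : w (i - K) = w j ∨ w (i - K) = w (j + 1) :=  hex.left_eq_or_eq (hlink j)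
    right
    rcases hj with hj | hj
    · left
      rcases hend with h | h
      · rw [h, show j = -K - ((-K - j).toNat : ℤ) by omega]
        exact hleft _
      · rw [h, show j + 1 = -K - ((-K - (j + 1)).toNat : ℤ) by omega]
        exact hleft _
    · right
      rcases hend with h | h
      · rw [h, show j = K + ((j - K).toNat : ℤ) by omega]
        exact hright _
      · rw [h, show j + 1 = K + ((j + 1 - K).toNat : ℤ) by omega]
        exact hright _
  · intro e he heG
    obtain ⟨i, h1, h2, rfl⟩ := hK e he heG
    exact ⟨(i + K).toNat, by omega, congrArg ε (by omega)⟩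

lemma IsExtendableTrail.injOn {G : Graph ℕ ℕ} {n : ℕ} {w ε : ℕ → ℕ}
    (h : IsExtendableTrail G n w ε) : Set.InjOn ε (Finset.range n : Set ℕ) := by
  intro i hi j hj hij
  simp only [Finset.coe_range, Set.mem_Iio] at hi hj
  rcases lt_trichotomy i j with hlt | rfl | hlt
  · exact absurd hij.symm (h.ne j hj i hlt)
  · rfl
  · exact absurd hij (h.ne i hi j hlt)

lemma isWalk_of_joins {s t : ℕ → ℕ} {w ε : ℕ → ℕ} (n : ℕ)
    (h : ∀ i < n, Joins s t (ε i) (w i) (w (i + 1))) :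
    IsWalk s t (w 0) ((List.range n).map fun i => (ε i, w (i + 1))) (w n) := by
  induction n with
  | zero => rfl
  | succ n ih =>
    rw [List.range_succ, List.map_append]
    exact isWalk_append.2 ⟨w n, ih fun i hi => h i (by omega), h n (by omega), rfl⟩

lemma exists_ends (G : Graph ℕ ℕ) : ∃ s t : ℕ → ℕ, ∀ e x y,
    G.IsLink e x y ↔ e ∈ G.edgeSet ∧ Joins s t e x y := by
  have : ∀ e, ∃ x y, e ∈ G.edgeSet → G.IsLink e x y := by
    intro e
    by_cases he : e ∈ G.edgeSet
    · obtain ⟨x, y, h⟩ := G.exists_isLink_of_mem_edgeSet he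
      exact ⟨x, y, fun _ => h⟩
    · exact ⟨0, 0, fun h => absurd h he⟩
  choose s t hst using this
  refine ⟨s, t, fun e x y => ⟨fun h => ⟨h.edge_mem, (hst e h.edge_mem).isLink_iff.1 h⟩,
    fun ⟨he, h⟩ => (hst e he).isLink_iff.2 h⟩⟩

theorem HasExtendableTrails.hasTwoWayEulerianPath {G : Graph ℕ ℕ} (hG : IsLocallyFinite G)
    (h : HasExtendableTrails G) : HasTwoWayEulerianPath G := by
  obtain ⟨s, t, hst⟩ := exists_ends G
  suffices ∃ (w : ℤ → ℕ) (ε : ℤ → ℕ), (∀ i, Joins s t (ε i) (w i) (w (i + 1))) ∧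
      Set.BijOn ε Set.univ G.edgeSet by
    obtain ⟨w, ε, h1, h2⟩ := this
    exact ⟨w, ε, fun i => (hst _ _ _).2 ⟨h2.mapsTo trivial, h1 i⟩, h2⟩
  apply exists_bi_infinite_trail
  · intro v
    by_cases hv : v ∈ G.vertexSet
    · exact (hG v hv).subset fun e ⟨he, x, hx⟩ => ⟨x, (hst _ _ _).2 ⟨he, hx⟩⟩
    · convert Set.finite_empty
      ext e
      simp only [Set.mem_ofPred_eq, Set.mem_empty_iff_false, iff_false]
      rintro ⟨he, x, hx⟩
      exact hv ((hst _ _ _).2 ⟨he, hx⟩).left_mem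
  · intro F hF
    obtain ⟨n, w, ε, hw, hN⟩ := h (F.sup id + 1)
    let P := (Finset.range n).image ε
    have hP : ∀ e, e ∈ P ↔ ∃ i < n, ε i = e := by simp [P]
    have hadj : ∀ x y, AdjAvoiding G n ε x y → AdjIn s t (G.edgeSet \ P) x y := by
      rintro x y ⟨e, he, hne⟩
      obtain ⟨h1, h2⟩ := (hst _ _ _).1 he
      exact ⟨e, ⟨h1, fun h => by obtain ⟨i, hi, h⟩ := (hP e).1 h; exact hne i hi h⟩, h2⟩
    have hE : edges ((List.range n).map fun i => (ε i, w (i + 1))) = (List.range n).map ε := by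
      simp [edges, Function.comp_def]
    have hreach : ∀ x y, Relation.ReflTransGen (AdjAvoiding G n ε) x y →
        ReachIn s t (G.edgeSet \ P) x y := fun x y h => Relation.ReflTransGen.mono hadj _ _ h
    refine ⟨P, w 0, w n, (List.range n).map fun i => (ε i, w (i + 1)), ?_,
      isWalk_of_joins n fun i hi => ((hst _ _ _).1 (hw.link i hi)).2, ?_, ?_, ?_, ?_, ?_, ?_⟩
    · intro e he
      exact (hP e).2 (hN e (Nat.lt_succ_of_le (Finset.le_sup (f := id) he)) (hF he))
    · rw [hE]
      refine List.Nodup.map_on ?_ List.nodup_range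
      exact fun i hi j hj => hw.injOn (by simpa using hi) (by simpa using hj)
    · intro e
      rw [hE, hP]
      simp
    · intro e he
      obtain ⟨i, hi, rfl⟩ := (hP e).1 he
      exact (hw.link i hi).edge_mem
    · obtain ⟨x, hx⟩ := hw.left
      obtain ⟨e, he, hj⟩ := hadj _ _ hx
      exact ⟨e, he, x, hj⟩
    · obtain ⟨x, hx⟩ := hw.right
      obtain ⟨e, he, hj⟩ := hadj _ _ hx
      exact ⟨e, he, x, hj⟩
    · rintro v ⟨e, he, x, hx⟩
      obtain ⟨i, hi, rfl⟩ := (hP e).1 he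
      obtain ⟨j, hj, rfl⟩ : ∃ j < n + 1, v = w j := by
        rcases ((hst _ _ _).2 ⟨(hw.link i hi).edge_mem, hx⟩).left_eq_or_eq (hw.link i hi) with h | h
        · exact ⟨i, by omega, h⟩
        · exact ⟨i + 1, by omega, h⟩
      refine (hw.reach j hj).imp ?_ (Or.imp (hreach _ _) (hreach _ _))
      intro hsat f hf y hy
      exact (hP f).2 (hsat f y ((hst _ _ _).2 ⟨hf, hy⟩))

theorem hasTwoWayEulerianPath_iff {G : Graph ℕ ℕ} (hG : IsLocallyFinite G) :
    HasTwoWayEulerianPath G ↔ HasExtendableTrails G :=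
  ⟨fun h => h.hasExtendableTrails, fun h => h.hasTwoWayEulerianPath hG⟩

/-! ## Semidecidable predicates -/

section Primrec

variable {α β γ : Type} [Primcodable α] [Primcodable β] [Primcodable γ]

attribute [fun_prop] Primrec
attribute [fun_prop] Primrec.id Primrec.const Primrec.fst Primrec.snd Primrec.pair

@[fun_prop] lemma primrec_self : Primrec fun a : α => a := Primrec.id

@[fun_prop] lemma primrec_comp {f : β → γ} {g : α → β} (hf : Primrec f) (hg : Primrec g) :
    Primrec fun a => f (g a) := hf.comp hg

@[fun_prop] lemma primrec_natPair {f g : α → ℕ} (hf : Primrec f) (hg : Primrec g) :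
    Primrec fun a => Nat.pair (f a) (g a) := Primrec₂.natPair.comp hf hg

@[fun_prop] lemma primrec_unpair : Primrec Nat.unpair := Primrec.unpair

@[fun_prop] lemma primrec_add {f g : α → ℕ} (hf : Primrec f) (hg : Primrec g) :
    Primrec fun a => f a + g a := Primrec.nat_add.comp hf hg

@[fun_prop] lemma primrec_min {f g : α → ℕ} (hf : Primrec f) (hg : Primrec g) :
    Primrec fun a => min (f a) (g a) := Primrec.nat_min.comp hf hg

@[fun_prop] lemma primrec_max {f g : α → ℕ} (hf : Primrec f) (hg : Primrec g) :
    Primrec fun a => max (f a) (g a) := Primrec.nat_max.comp hf hg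

/-- The `i`-th entry of the list with code `c`. -/
def entry (c i : ℕ) : ℕ := (Denumerable.ofNat (List ℕ) c).getD i 0

@[fun_prop] lemma primrec_entry {f g : α → ℕ} (hf : Primrec f) (hg : Primrec g) :
    Primrec fun a => entry (f a) (g a) :=
  (Primrec.list_getD 0).comp ((Primrec.ofNat (List ℕ)).comp hf) hg

lemma exists_entry_eq (n : ℕ) (f : ℕ → ℕ) : ∃ c, ∀ i < n, entry c i = f i := by
  refine ⟨Encodable.encode ((List.range n).map f), fun i hi => ?_⟩
  simp [entry, hi]

lemma primrecPred_forall_lt {p : α → ℕ → Prop} (h : PrimrecPred fun a : α × ℕ => p a.1 a.2)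
    {f : α → ℕ} (hf : Primrec f) : PrimrecPred fun a => ∀ i < f a, p a i := by
  have hrel : PrimrecRel fun (i : ℕ) (a : α) => p a i :=
    h.comp (f := fun x : ℕ × α => (x.2, x.1)) (by fun_prop)
  exact (PrimrecRel.comp (f := fun a : α => List.range (f a)) (g := fun a => a)
    hrel.forall_mem_list (Primrec.list_range.comp hf) Primrec.id).of_eq (by simp)

end Primrec

/-- A predicate is semidecidable if it has the form `∃ k, R a k` with `R` primitive recursive. -/
def IsSemidecidable {α : Type} [Primcodable α] (p : α → Prop) : Prop :=
  ∃ R : α × ℕ → Prop, PrimrecPred R ∧ ∀ a, p a ↔ ∃ k, R (a, k)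

namespace IsSemidecidable

variable {α β : Type} [Primcodable α] [Primcodable β] {p q : α → Prop}

lemma of_primrecPred (h : PrimrecPred p) : IsSemidecidable p :=
  ⟨fun a => p a.1, h.comp Primrec.fst, by simp⟩

lemma of_iff (h : IsSemidecidable p) (hpq : ∀ a, q a ↔ p a) : IsSemidecidable q :=
  (funext fun a => propext (hpq a) : q = p) ▸ h

lemma comp {p : β → Prop} (h : IsSemidecidable p) {f : α → β} (hf : Primrec f) :
    IsSemidecidable fun a => p (f a) := by
  obtain ⟨R, hR, h⟩ := h
  exact ⟨fun a => R (f a.1, a.2), hR.comp (by fun_prop), fun a => h _⟩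

lemma eq {f g : α → ℕ} (hf : Primrec f) (hg : Primrec g) : IsSemidecidable fun a => f a = g a :=
  of_primrecPred (Primrec.eq.comp hf hg)

lemma ne {f g : α → ℕ} (hf : Primrec f) (hg : Primrec g) : IsSemidecidable fun a => f a ≠ g a :=
  of_primrecPred (Primrec.eq.comp hf hg).not

lemma lt {f g : α → ℕ} (hf : Primrec f) (hg : Primrec g) : IsSemidecidable fun a => f a < g a :=
  of_primrecPred (Primrec.nat_lt.comp hf hg)

lemma le {f g : α → ℕ} (hf : Primrec f) (hg : Primrec g) : IsSemidecidable fun a => f a ≤ g a :=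
  of_primrecPred (Primrec.nat_le.comp hf hg)

lemma ex {p : α → ℕ → Prop} (h : IsSemidecidable fun a : α × ℕ => p a.1 a.2) :
    IsSemidecidable fun a => ∃ n, p a n := by
  obtain ⟨R, hR, h⟩ := h
  refine ⟨fun a => R ((a.1, a.2.unpair.1), a.2.unpair.2), hR.comp (by fun_prop), fun a => ?_⟩
  constructor
  · rintro ⟨n, hn⟩
    obtain ⟨k, hk⟩ := (h (a, n)).1 hn
    exact ⟨Nat.pair n k, by simpa using hk⟩
  · rintro ⟨k, hk⟩
    exact ⟨_, (h (a, k.unpair.1)).2 ⟨_, hk⟩⟩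

protected lemma and (hp : IsSemidecidable p) (hq : IsSemidecidable q) :
    IsSemidecidable fun a => p a ∧ q a := by
  obtain ⟨R, hR, hp⟩ := hp
  obtain ⟨S, hS, hq⟩ := hq
  refine ⟨fun a => R (a.1, a.2.unpair.1) ∧ S (a.1, a.2.unpair.2),
    (hR.comp (by fun_prop)).and (hS.comp (by fun_prop)), fun a => ?_⟩
  simp only [hp, hq]
  constructor
  · rintro ⟨⟨k, hk⟩, l, hl⟩
    exact ⟨Nat.pair k l, by simpa using ⟨hk, hl⟩⟩
  · rintro ⟨k, h1, h2⟩
    exact ⟨⟨_, h1⟩, _, h2⟩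

protected lemma or (hp : IsSemidecidable p) (hq : IsSemidecidable q) :
    IsSemidecidable fun a => p a ∨ q a := by
  obtain ⟨R, hR, hp⟩ := hp
  obtain ⟨S, hS, hq⟩ := hq
  refine ⟨fun a => R (a.1, a.2) ∨ S (a.1, a.2), hR.or hS, fun a => ?_⟩
  simp only [hp, hq, exists_or]

/-- The finitely many witnesses are collected in one coded list. -/
lemma forall_lt {p : α → ℕ → Prop} (h : IsSemidecidable fun a : α × ℕ => p a.1 a.2) {f : α → ℕ}
    (hf : Primrec f) : IsSemidecidable fun a => ∀ i < f a, p a i := by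
  obtain ⟨R, hR, h⟩ := h
  refine ⟨fun a => ∀ i < f a.1, R ((a.1, i), entry a.2 i), primrecPred_forall_lt
    (hR.comp (f := fun x : (α × ℕ) × ℕ => ((x.1.1, x.2), entry x.1.2 x.2)) (by fun_prop))
    (hf.comp Primrec.fst), fun a => ?_⟩
  constructor
  · intro ha
    have : ∀ i, ∃ k, i < f a → R ((a, i), k) := by
      intro i
      by_cases hi : i < f a
      · obtain ⟨k, hk⟩ := (h (a, i)).1 (ha i hi)
        exact ⟨k, fun _ => hk⟩
      · exact ⟨0, fun h => absurd h hi⟩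
    choose k hk using this
    obtain ⟨c, hc⟩ := exists_entry_eq (f a) k
    exact ⟨c, fun i hi => by simpa [hc i hi] using hk i hi⟩
  · rintro ⟨c, hc⟩ i hi
    exact (h (a, i)).2 ⟨_, hc i hi⟩

lemma exists_lt {p : α → ℕ → Prop} (h : IsSemidecidable fun a : α × ℕ => p a.1 a.2) {f : α → ℕ}
    (hf : Primrec f) : IsSemidecidable fun a => ∃ i < f a, p a i :=
  ex ((lt Primrec.snd (hf.comp Primrec.fst)).and h)

/-- A finite path is a coded list of vertices, with semidecidable conditions on consecutive entries.
-/
lemma reflTransGen {r : α → ℕ → ℕ → Prop}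
    (h : IsSemidecidable fun a : (α × ℕ) × ℕ => r a.1.1 a.1.2 a.2) {f g : α → ℕ}
    (hf : Primrec f) (hg : Primrec g) :
    IsSemidecidable fun a => Relation.ReflTransGen (r a) (f a) (g a) := by
  have key : IsSemidecidable fun a => ∃ c n, entry c 0 = f a ∧ entry c n = g a ∧
      ∀ i < n, r a (entry c i) (entry c (i + 1)) := by
    refine ex (ex (.and (eq ?_ ?_) (.and (eq ?_ ?_) (forall_lt ?_ ?_))))
    any_goals fun_prop
    exact h.comp (f := fun x : ((α × ℕ) × ℕ) × ℕ =>
      ((x.1.1.1, entry x.1.1.2 x.2), entry x.1.1.2 (x.2 + 1))) (by fun_prop)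
  refine key.of_iff fun a => ⟨fun ha => ?_, ?_⟩
  · suffices ∃ (w : ℕ → ℕ) (n : ℕ), w 0 = f a ∧ w n = g a ∧ ∀ i < n, r a (w i) (w (i + 1)) by
      obtain ⟨w, n, h1, h2, h3⟩ := this
      obtain ⟨c, hc⟩ := exists_entry_eq (n + 1) w
      refine ⟨c, n, by rw [hc 0 (by omega), h1], by rw [hc n (by omega), h2], fun i hi => ?_⟩
      rw [hc i (by omega), hc (i + 1) (by omega)]
      exact h3 i hi
    generalize f a = x, g a = y at ha
    induction ha with
    | refl => exact ⟨fun _ => x, 0, rfl, rfl, by simp⟩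
    | @tail y z _ hyz ih =>
      obtain ⟨w, n, h1, h2, h3⟩ := ih
      refine ⟨fun i => if i ≤ n then w i else z, n + 1, by simpa using h1, by simp, fun i hi => ?_⟩
      rcases Nat.lt_succ_iff_lt_or_eq.1 hi with hi | rfl
      · simpa [hi.le, Nat.succ_le_of_lt hi] using h3 i hi
      · simpa [h2] using hyz
  · rintro ⟨c, n, h1, h2, h3⟩
    rw [← h1, ← h2]
    clear h2
    induction n with
    | zero => exact .refl
    | succ n ih => exact (ih fun i hi => h3 i (by omega)).tail (h3 n (by omega))

lemma mem_phi {f g h : α → ℕ} (hf : Primrec f) (hg : Primrec g) (hh : Primrec h) :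
    IsSemidecidable fun a => h a ∈ phi (f a) (g a) := by
  refine ⟨fun a => Nat.Partrec.Code.evaln a.2 (Denumerable.ofNat Nat.Partrec.Code (f a.1)) (g a.1)
    = some (h a.1), Primrec.eq.comp (Nat.Partrec.Code.primrec_evaln.comp
      (Primrec.pair (Primrec.pair Primrec.snd ((Primrec.ofNat Nat.Partrec.Code).comp
        (hf.comp Primrec.fst))) (hg.comp Primrec.fst)))
      (Primrec.option_some.comp (hh.comp Primrec.fst)), fun a => ?_⟩
  exact Nat.Partrec.Code.evaln_complete

end IsSemidecidable

lemma isPi02_of_forall {A : Set ℕ} {p : ℕ → ℕ → Prop}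
    (hp : IsSemidecidable fun a : ℕ × ℕ => p a.1 a.2) (h : ∀ x, x ∈ A ↔ ∀ y, p x y) :
    IsPi02 A := by
  obtain ⟨R, hR, hpR⟩ := hp
  refine ⟨fun x y z => ¬ R ((x, y), z), ?_, fun x => ?_⟩
  · exact (hR.comp (f := fun a : ℕ × ℕ × ℕ => ((a.1, a.2.1), a.2.2))
      (by fun_prop)).not.computablePred
  · rw [Set.mem_compl_iff, h]
    push Not
    refine exists_congr fun y => ?_
    exact (not_congr (hpR (x, y))).trans not_exists

lemma IsPi02.preimage {A : Set ℕ} (hA : IsPi02 A) {f : ℕ → ℕ} (hf : Computable f) :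
    IsPi02 (f ⁻¹' A) := by
  obtain ⟨R, hR, h⟩ := hA
  refine ⟨fun x y z => R (f x) y z, ?_, fun x => h (f x)⟩
  classical
  rw [computablePred_iff_computable_decide] at hR ⊢
  exact hR.comp (g := fun a : ℕ × ℕ × ℕ => (f a.1, a.2))
    ((hf.comp Computable.fst).pair Computable.snd)

/-! ## Canonical multigraphs -/

lemma edgeMultiplicity_comm (G : Graph ℕ ℕ) (u v : ℕ) :
    edgeMultiplicity G u v = edgeMultiplicity G v u := by
  simp only [edgeMultiplicity, G.isLink_comm (x := u)]

lemma edgeMultiplicity_of_notMem {G : Graph ℕ ℕ} {u v : ℕ} (hu : u ∉ G.vertexSet) :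
    edgeMultiplicity G u v = 0 := by
  have : {e | G.IsLink e u v} = ∅ := by
    ext e; simpa using fun h => hu (Graph.IsLink.left_mem h)
  rw [edgeMultiplicity, this, Set.ncard_empty]

lemma IsLocallyFinite.finite_inc {G : Graph ℕ ℕ} (hG : IsLocallyFinite G) (v : ℕ) :
    {e | G.Inc e v}.Finite := by
  by_cases hv : v ∈ G.vertexSet
  · exact hG v hv
  · have : {e | G.Inc e v} = ∅ := by
      ext e; simpa using fun ⟨x, hx⟩ => hv hx.left_mem
    simp [this]

lemma IsLocallyFinite.finite_isLink {G : Graph ℕ ℕ} (hG : IsLocallyFinite G) (u v : ℕ) :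
    {e | G.IsLink e u v}.Finite :=
  (hG.finite_inc u).subset fun _ h => ⟨v, h⟩

lemma IsLocallyFinite.edgeMultiplicity_ne_zero {G : Graph ℕ ℕ} (hG : IsLocallyFinite G) {u v : ℕ} :
    edgeMultiplicity G u v ≠ 0 ↔ ∃ e, G.IsLink e u v := by
  rw [edgeMultiplicity, Ne, Set.ncard_eq_zero (hG.finite_isLink u v), ← Ne,
    ← Set.nonempty_iff_ne_empty]
  rfl

lemma IsLocallyFinite.exists_bound {G : Graph ℕ ℕ} (hG : IsLocallyFinite G) (v : ℕ) :
    ∃ M, ∀ u ≥ M, edgeMultiplicity G u v = 0 := by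
  have hfin : {u | ∃ e, G.IsLink e u v}.Finite := by
    refine ((hG.finite_inc v).biUnion (t := fun e => {u | G.IsLink e u v}) fun e _ => ?_).subset ?_
    · exact Set.Subsingleton.finite fun x hx y hy => Graph.IsLink.left_unique hx hy
    · rintro u ⟨e, he⟩
      exact Set.mem_biUnion (x := e) ⟨u, he.symm⟩ he
  obtain ⟨M, hM⟩ := hfin.bddAbove
  refine ⟨M + 1, fun u hu => ?_⟩
  by_contra h
  have := hM (hG.edgeMultiplicity_ne_zero.1 h)
  omega

lemma IsLocallyFinite.ncard_inc {G : Graph ℕ ℕ} (hG : IsLocallyFinite G) (v M : ℕ) :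
    {e | ∃ u < M, G.IsLink e u v}.ncard = ∑ u ∈ Finset.range M, edgeMultiplicity G u v := by
  induction M with
  | zero => simp
  | succ M ih =>
    have : {e | ∃ u < M + 1, G.IsLink e u v} =
        {e | ∃ u < M, G.IsLink e u v} ∪ {e | G.IsLink e M v} := by
      ext e
      simp only [Nat.lt_succ_iff_lt_or_eq, Set.mem_union, Set.mem_ofPred_eq, or_and_right,
        exists_or, exists_eq_left]
    have hfin : {e | ∃ u < M, G.IsLink e u v}.Finite :=
      (hG.finite_inc v).subset (by rintro e ⟨u, -, h⟩; exact ⟨u, h.symm⟩)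
    rw [this, Set.ncard_union_eq ?_ hfin (hG.finite_isLink M v), ih, Finset.sum_range_succ, edgeMultiplicity]
    rw [Set.disjoint_left]
    rintro e ⟨u, hu, h⟩ (h' : G.IsLink e M v)
    exact hu.ne (h.left_unique h')

/-- The sum counts every edge at `v` once, by its other end. Loops occur in it for `u = v` and have
to be counted once more. -/
lemma IsLocallyFinite.degree_eq {G : Graph ℕ ℕ} (hG : IsLocallyFinite G) (v M : ℕ)
    (hM : ∀ u ≥ M, edgeMultiplicity G u v = 0) :
    degree G v = edgeMultiplicity G v v + ∑ u ∈ Finset.range M, edgeMultiplicity G u v := by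
  rw [← hG.ncard_inc]
  have h1 : {e | ∃ u < M, G.IsLink e u v} = {e | G.IsNonloopAt e v} ∪ {e | G.IsLoopAt e v} := by
    ext e
    constructor
    · rintro ⟨u, -, h⟩
      by_cases huv : u = v
      · subst huv; exact Or.inr h
      · exact Or.inl ⟨u, huv, h.symm⟩
    · have key : ∀ u, G.IsLink e u v → ∃ u < M, G.IsLink e u v := by
        intro u h
        refine ⟨u, ?_, h⟩
        by_contra hu
        exact hG.edgeMultiplicity_ne_zero.2 ⟨e, h⟩ (hM u (by omega))
      rintro (⟨u, -, h⟩ | h)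
      · exact key u h.symm
      · exact key v h
  have h2 : {e | G.IsLoopAt e v} = {e | G.IsLink e v v} := rfl
  have hfin : {e | G.IsNonloopAt e v}.Finite :=
    (hG.finite_inc v).subset (by rintro e ⟨u, -, h⟩; exact ⟨u, h⟩)
  rw [h1, Set.ncard_union_eq ?_ hfin (h2 ▸ hG.finite_isLink v v), degree,
    edgeMultiplicity, h2]
  · ring
  · rw [Set.disjoint_left]
    rintro e ⟨u, hu, h⟩ (h' : G.IsLink e v v)
    exact hu (h.right_unique h')

/-- The label of the `i`-th edge between `u` and `v`. -/
def edgeLabel (u v i : ℕ) : ℕ := Nat.pair (Nat.pair (min u v) (max u v)) i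

lemma edgeLabel_comm (u v i : ℕ) : edgeLabel u v i = edgeLabel v u i := by
  rw [edgeLabel, edgeLabel, min_comm, max_comm]

lemma edgeLabel_inj {u v i u' v' i' : ℕ} (h : edgeLabel u v i = edgeLabel u' v' i') :
    ((u = u' ∧ v = v') ∨ (u = v' ∧ v = u')) ∧ i = i' := by
  simp only [edgeLabel, Nat.pair_eq_pair] at h
  omega

/-- The multigraph with vertex set `V` and `m u v` edges between `u` and `v`
(for symmetric `m` with support in `V`). -/
def canonicalGraph (V : Set ℕ) (m : ℕ → ℕ → ℕ) : Graph ℕ ℕ where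
  vertexSet := V
  IsLink e x y := x ∈ V ∧ y ∈ V ∧ ∃ i < m x y, i < m y x ∧ e = edgeLabel x y i
  isLink_symm e _ := ⟨by
    rintro x y ⟨hx, hy, i, h1, h2, h3⟩
    exact ⟨hy, hx, i, h2, h1, h3.trans (edgeLabel_comm _ _ _)⟩⟩
  eq_or_eq_of_isLink_of_isLink := by
    rintro e x y v w ⟨-, -, i, -, -, h⟩ ⟨-, -, j, -, -, h'⟩
    rcases (edgeLabel_inj (h.symm.trans h')).1 with h | h
    · exact Or.inl h.1
    · exact Or.inr h.1
  left_mem_of_isLink _ _ _ h := h.1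

/-- The conditions on `V` and `m` to describe a locally finite multigraph. -/
structure IsMultiplicity (V : Set ℕ) (m : ℕ → ℕ → ℕ) : Prop where
  symm : ∀ u v, m u v = m v u
  mem : ∀ u v, m u v ≠ 0 → u ∈ V
  bound : ∀ v, ∃ M, ∀ u ≥ M, m u v = 0

namespace IsMultiplicity

variable {V : Set ℕ} {m : ℕ → ℕ → ℕ}

lemma isLink_iff (h : IsMultiplicity V m) {e x y : ℕ} :
    (canonicalGraph V m).IsLink e x y ↔ ∃ i < m x y, e = edgeLabel x y i := by
  constructor
  · rintro ⟨-, -, i, h1, -, h2⟩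
    exact ⟨i, h1, h2⟩
  · rintro ⟨i, h1, h2⟩
    exact ⟨h.mem x y (by omega), h.mem y x (by rw [h.symm]; omega), i, h1, by rwa [h.symm], h2⟩

lemma edgeMultiplicity_eq (h : IsMultiplicity V m) (u v : ℕ) :
    edgeMultiplicity (canonicalGraph V m) u v = m u v := by
  have : {e | (canonicalGraph V m).IsLink e u v} =
      (((Finset.range (m u v)).image (edgeLabel u v) : Finset ℕ) : Set ℕ) := by
    ext e
    simp only [Set.mem_ofPred_eq, h.isLink_iff, Finset.coe_image, Finset.coe_range, Set.mem_image,
      Set.mem_Iio, eq_comm]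
  rw [edgeMultiplicity, this, Set.ncard_coe_finset, Finset.card_image_of_injective,
    Finset.card_range]
  exact fun i j hij => (edgeLabel_inj hij).2

lemma isLocallyFinite (h : IsMultiplicity V m) : IsLocallyFinite (canonicalGraph V m) := by
  intro v _
  obtain ⟨M, hM⟩ := h.bound v
  refine (((Finset.range M).biUnion fun u =>
    (Finset.range (m v u)).image (edgeLabel v u)).finite_toSet).subset ?_
  rintro e ⟨u, hu⟩
  obtain ⟨i, hi, rfl⟩ := h.isLink_iff.1 hu
  have hu : u < M := by
    by_contra hu
    have := hM u (by omega)
    rw [h.symm] at this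
    omega
  simp only [Finset.coe_biUnion, Set.mem_iUnion, Finset.coe_image, Set.mem_image, Finset.coe_range,
    Set.mem_Iio]
  exact ⟨u, hu, i, hi, rfl⟩

lemma degree_eq (h : IsMultiplicity V m) {v M : ℕ} (hM : ∀ u ≥ M, m u v = 0) :
    degree (canonicalGraph V m) v = m v v + ∑ u ∈ Finset.range M, m u v := by
  rw [h.isLocallyFinite.degree_eq v M (by simpa only [h.edgeMultiplicity_eq])]
  simp only [h.edgeMultiplicity_eq]

end IsMultiplicity

/-! ### Renaming the edges canonically -/

section Transfer

variable {G : Graph ℕ ℕ}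

lemma IsLocallyFinite.isMultiplicity (hG : IsLocallyFinite G) :
    IsMultiplicity G.vertexSet (edgeMultiplicity G) where
  symm := edgeMultiplicity_comm G
  mem u v h := by
    by_contra hu
    exact h (edgeMultiplicity_of_notMem hu)
  bound := hG.exists_bound

lemma IsLocallyFinite.connected_canonicalGraph (hG : IsLocallyFinite G) (hc : Connected G) :
    Connected (canonicalGraph G.vertexSet (edgeMultiplicity G)) := by
  refine ⟨hc.1, fun u hu v hv => Relation.ReflTransGen.mono ?_ _ _ (hc.2 u hu v hv)⟩
  rintro x y ⟨e, he⟩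
  have := hG.edgeMultiplicity_ne_zero.2 ⟨e, he⟩
  exact ⟨edgeLabel x y 0, hG.isMultiplicity.isLink_iff.2 ⟨0, by omega, rfl⟩⟩

/-- Renaming each edge by its ends and its rank among its parallel edges is a bijection of edge sets
that preserves ends. -/
lemma IsLocallyFinite.hasTwoWayEulerianPath_canonicalGraph (hG : IsLocallyFinite G)
    (h : HasTwoWayEulerianPath G) :
    HasTwoWayEulerianPath (canonicalGraph G.vertexSet (edgeMultiplicity G)) := by
  classical
  have hm := hG.isMultiplicity
  obtain ⟨s, t, hst⟩ := exists_ends G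
  let f : ℕ → ℕ := fun e => edgeLabel (s e) (t e) (Nat.count (fun d => G.IsLink d (s e) (t e)) e)
  have hf : ∀ {e x y}, G.IsLink e x y →
      f e = edgeLabel x y (Nat.count (fun d => G.IsLink d x y) e) := by
    intro e x y h
    rcases ((hst e x y).1 h).2 with ⟨rfl, rfl⟩ | ⟨rfl, rfl⟩
    · rfl
    · simp only [f, edgeLabel_comm (t e), G.isLink_comm (x := t e)]
  have hcard : ∀ x y (hfin : {e | G.IsLink e x y}.Finite),
      hfin.toFinset.card = edgeMultiplicity G x y := fun x y hfin =>
    (Set.ncard_eq_toFinset_card _ hfin).symm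
  have hlink : ∀ {e x y}, G.IsLink e x y →
      (canonicalGraph G.vertexSet (edgeMultiplicity G)).IsLink (f e) x y := by
    intro e x y h
    refine hm.isLink_iff.2 ⟨_, ?_, hf h⟩
    rw [← hcard x y (hG.finite_isLink x y)]
    exact Nat.count_lt_card _ h
  have hbij : Set.BijOn f G.edgeSet
      (canonicalGraph G.vertexSet (edgeMultiplicity G)).edgeSet := by
    refine ⟨fun e he => ?_, fun e he e' he' hee => ?_, fun l hl => ?_⟩
    · obtain ⟨x, y, h⟩ := G.exists_isLink_of_mem_edgeSet he
      exact (hlink h).edge_mem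
    · obtain ⟨x, y, h⟩ := G.exists_isLink_of_mem_edgeSet he
      have h1 := hlink h
      rw [hee] at h1
      obtain ⟨x', y', h'⟩ := G.exists_isLink_of_mem_edgeSet he'
      have h2 : G.IsLink e' x y := by
        rcases h1.eq_and_eq_or_eq_and_eq (hlink h') with ⟨rfl, rfl⟩ | ⟨rfl, rfl⟩
        · exact h'
        · exact h'.symm
      rw [hf h, hf h2] at hee
      exact Nat.count_injective h h2 (edgeLabel_inj hee).2
    · obtain ⟨x, y, h⟩ := Graph.exists_isLink_of_mem_edgeSet hl
      obtain ⟨i, hi, rfl⟩ := hm.isLink_iff.1 h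
      have hfin := hG.finite_isLink x y
      rw [← hcard x y hfin] at hi
      have h1 : G.IsLink (Nat.nth (fun d => G.IsLink d x y) i) x y := Nat.nth_mem_of_lt_card hfin hi
      refine ⟨_, h1.edge_mem, ?_⟩
      rw [hf h1, Nat.count_nth fun _ => hi]
  obtain ⟨w, ε, h1, h2⟩ := h
  exact ⟨w, f ∘ ε, fun i => hlink (h1 i), hbij.comp h2⟩

end Transfer

/-! ## The decision problem is `Π⁰₂` -/

/-- The number of edges between `u` and `v` in the multigraph with index `e` is `k`. -/
def MultIs (e u v k : ℕ) : Prop := k ∈ phi e.unpair.2.unpair.1 (Nat.pair u v)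

/-- The `a`-th program with index `e` on vertices has value `k` at `v`. -/
def VertIs (e v k : ℕ) : Prop := k ∈ phi e.unpair.1 v

/-- All neighbours of `v` in the multigraph with index `e` are less than `M`, as is witnessed by
the degree of `v`. -/
def NeighborsLt (e v M : ℕ) : Prop :=
  ∃ c, MultIs e v v (entry c 0) ∧
    (∀ u < M, ∃ k, MultIs e u v k ∧ entry c (u + 1) = entry c u + k) ∧
    entry c M ∈ phi e.unpair.2.unpair.2 v

/-- The label `l` is that of an edge between `x` and `y` in the multigraph with index `e`. -/
def LinkIs (e l x y : ℕ) : Prop := ∃ k, MultIs e x y k ∧ ∃ i < k, l = edgeLabel x y i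

/-- Adjacency avoiding the edges listed by `c`. -/
def AdjIs (e n c x y : ℕ) : Prop := ∃ l, LinkIs e l x y ∧ ∀ i < n, entry c i ≠ l

/-- All edges at `v` are listed by `c`. -/
def Saturated (e n c v : ℕ) : Prop :=
  ∃ M, NeighborsLt e v M ∧ ∀ u < M, ∃ k, MultIs e u v k ∧
    ∀ i < k, ∃ j < n, entry c j = edgeLabel u v i

/-- The codes `b` and `c` describe an extendable trail of length `n`. -/
def TrailIs (e n b c : ℕ) : Prop :=
  (∀ i < n, LinkIs e (entry c i) (entry b i) (entry b (i + 1))) ∧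
  (∀ i < n, ∀ j < i, entry c i ≠ entry c j) ∧
  (∃ x, AdjIs e n c (entry b 0) x) ∧
  (∃ x, AdjIs e n c (entry b n) x) ∧
  ∀ i < n + 1, Saturated e n c (entry b i) ∨
    Relation.ReflTransGen (AdjIs e n c) (entry b 0) (entry b i) ∨
    Relation.ReflTransGen (AdjIs e n c) (entry b n) (entry b i)

/-- Every edge with label less than `N` is listed by `c`. -/
def CoversLt (e n c N : ℕ) : Prop :=
  ∀ u < N, ∀ v < N, ∃ k, MultIs e u v k ∧ ∀ i < N, k ≤ i ∨ ∃ j < n, entry c j = edgeLabel u v i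

/-- The conjunction of all conditions for membership in the decision problem. -/
def ProblemMatrix (e u v : ℕ) : Prop :=
  (VertIs e u 0 ∨ VertIs e u 1) ∧
  (∃ k, MultIs e u v k ∧ MultIs e v u k) ∧
  (MultIs e u v 0 ∨ VertIs e u 1) ∧
  -- Through `v` this is required for arbitrarily large `M`: a single `M` would only say that the
  -- alleged degree agrees with one partial sum.
  (∃ M, v ≤ M ∧ NeighborsLt e u M) ∧
  (∃ x, VertIs e x 1) ∧
  (VertIs e u 0 ∨ VertIs e v 0 ∨
    Relation.ReflTransGen (fun x y => ∃ k, MultIs e x y (k + 1)) u v) ∧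
  -- Here `u` is not a vertex, but the bound on the edges to be covered.
  ∃ n b c, TrailIs e n b c ∧ CoversLt e n c u

/-! ### Semidecidability of the matrix -/

section Semidecidable

open IsSemidecidable

variable {α : Type} [Primcodable α]

@[fun_prop] lemma primrec_edgeLabel {f g h : α → ℕ} (hf : Primrec f) (hg : Primrec g)
    (hh : Primrec h) : Primrec fun a => edgeLabel (f a) (g a) (h a) := by
  unfold edgeLabel; fun_prop

lemma isSemidecidable_multIs {e u v k : α → ℕ} (he : Primrec e) (hu : Primrec u) (hv : Primrec v)
    (hk : Primrec k) : IsSemidecidable fun a => MultIs (e a) (u a) (v a) (k a) :=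
  mem_phi (by fun_prop) (by fun_prop) (by fun_prop)

lemma isSemidecidable_vertIs {e v k : α → ℕ} (he : Primrec e) (hv : Primrec v)
    (hk : Primrec k) : IsSemidecidable fun a => VertIs (e a) (v a) (k a) :=
  mem_phi (by fun_prop) (by fun_prop) (by fun_prop)

lemma isSemidecidable_neighborsLt {e v M : α → ℕ} (he : Primrec e) (hv : Primrec v)
    (hM : Primrec M) : IsSemidecidable fun a => NeighborsLt (e a) (v a) (M a) := by
  unfold NeighborsLt
  repeat' with_reducible first
    | apply isSemidecidable_multIs | apply mem_phi | apply forall_lt | apply ex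
    | apply IsSemidecidable.and | apply IsSemidecidable.eq | fun_prop

lemma isSemidecidable_linkIs {e l x y : α → ℕ} (he : Primrec e) (hl : Primrec l)
    (hx : Primrec x) (hy : Primrec y) :
    IsSemidecidable fun a => LinkIs (e a) (l a) (x a) (y a) := by
  unfold LinkIs
  repeat' with_reducible first
    | apply isSemidecidable_multIs | apply IsSemidecidable.exists_lt | apply ex
    | apply IsSemidecidable.and | apply IsSemidecidable.eq | fun_prop

lemma isSemidecidable_adjIs {e n c x y : α → ℕ} (he : Primrec e) (hn : Primrec n)
    (hc : Primrec c) (hx : Primrec x) (hy : Primrec y) :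
    IsSemidecidable fun a => AdjIs (e a) (n a) (c a) (x a) (y a) := by
  unfold AdjIs
  repeat' with_reducible first
    | apply isSemidecidable_linkIs | apply forall_lt | apply ex | apply IsSemidecidable.and
    | apply IsSemidecidable.ne | fun_prop

lemma isSemidecidable_saturated {e n c v : α → ℕ} (he : Primrec e) (hn : Primrec n)
    (hc : Primrec c) (hv : Primrec v) :
    IsSemidecidable fun a => Saturated (e a) (n a) (c a) (v a) := by
  unfold Saturated
  repeat' with_reducible first
    | apply isSemidecidable_neighborsLt | apply isSemidecidable_multIs | apply forall_lt
    | apply IsSemidecidable.exists_lt | apply ex | apply IsSemidecidable.and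
    | apply IsSemidecidable.eq | fun_prop

lemma isSemidecidable_trailIs {e n b c : α → ℕ} (he : Primrec e) (hn : Primrec n)
    (hb : Primrec b) (hc : Primrec c) :
    IsSemidecidable fun a => TrailIs (e a) (n a) (b a) (c a) := by
  unfold TrailIs
  repeat' with_reducible first
    | apply isSemidecidable_linkIs | apply isSemidecidable_adjIs | apply isSemidecidable_saturated
    | apply reflTransGen | apply forall_lt | apply ex | apply IsSemidecidable.and
    | apply IsSemidecidable.or | apply IsSemidecidable.ne | fun_prop

lemma isSemidecidable_coversLt {e n c N : α → ℕ} (he : Primrec e) (hn : Primrec n)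
    (hc : Primrec c) (hN : Primrec N) :
    IsSemidecidable fun a => CoversLt (e a) (n a) (c a) (N a) := by
  unfold CoversLt
  repeat' with_reducible first
    | apply isSemidecidable_multIs | apply forall_lt | apply IsSemidecidable.exists_lt | apply ex
    | apply IsSemidecidable.and | apply IsSemidecidable.or | apply IsSemidecidable.le
    | apply IsSemidecidable.eq | fun_prop

lemma isSemidecidable_problemMatrix {e u v : α → ℕ} (he : Primrec e) (hu : Primrec u)
    (hv : Primrec v) : IsSemidecidable fun a => ProblemMatrix (e a) (u a) (v a) := by
  unfold ProblemMatrix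
  repeat' with_reducible first
    | apply isSemidecidable_vertIs | apply isSemidecidable_multIs
    | apply isSemidecidable_neighborsLt | apply isSemidecidable_trailIs
    | apply isSemidecidable_coversLt | apply reflTransGen | apply ex | apply IsSemidecidable.and
    | apply IsSemidecidable.or | apply IsSemidecidable.le | fun_prop

end Semidecidable

/-! ### Correctness of the matrix -/

open Classical in
/-- The programs with index `e` compute `V`, `m` and `d`, which describe a multigraph. -/
structure Presents (e : ℕ) (V : Set ℕ) (m : ℕ → ℕ → ℕ) (d : ℕ → ℕ) : Prop where
  vert : ∀ v, phi e.unpair.1 v = Part.some (if v ∈ V then 1 else 0)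
  mult : ∀ u v, phi e.unpair.2.unpair.1 (Nat.pair u v) = Part.some (m u v)
  deg : ∀ v, phi e.unpair.2.unpair.2 v = Part.some (d v)
  isMultiplicity : IsMultiplicity V m
  deg_eq : ∀ v M, (∀ u ≥ M, m u v = 0) → d v = m v v + ∑ u ∈ Finset.range M, m u v

lemma IsIndex.presents {e : ℕ} {G : Graph ℕ ℕ} (h : IsIndex e G) :
    Presents e G.vertexSet (edgeMultiplicity G) (degree G) :=
  ⟨h.2.1, h.2.2.1, h.2.2.2, h.1.isMultiplicity, h.1.degree_eq⟩

namespace Presents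

variable {e : ℕ} {V : Set ℕ} {m : ℕ → ℕ → ℕ} {d : ℕ → ℕ}

lemma isIndex (h : Presents e V m d) : IsIndex e (canonicalGraph V m) := by
  refine ⟨h.isMultiplicity.isLocallyFinite, h.vert, fun u v => ?_, fun v => ?_⟩
  · rw [h.mult, h.isMultiplicity.edgeMultiplicity_eq]
  · obtain ⟨M, hM⟩ := h.isMultiplicity.bound v
    rw [h.deg, h.isMultiplicity.degree_eq hM, h.deg_eq v M hM]

lemma multIs_iff (h : Presents e V m d) {u v k : ℕ} : MultIs e u v k ↔ k = m u v := by
  rw [MultIs, h.mult, Part.mem_some_iff]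

lemma vertIs_one_iff (h : Presents e V m d) {v : ℕ} : VertIs e v 1 ↔ v ∈ V := by
  rw [VertIs, h.vert, Part.mem_some_iff]
  split_ifs <;> simp_all

lemma vertIs_zero_iff (h : Presents e V m d) {v : ℕ} : VertIs e v 0 ↔ v ∉ V := by
  rw [VertIs, h.vert, Part.mem_some_iff]
  split_ifs <;> simp_all

/-- Multiplicities are natural numbers, so a partial sum that already equals the degree leaves no
room for neighbours from `M` on. -/
lemma neighborsLt_iff (h : Presents e V m d) {v M : ℕ} :
    NeighborsLt e v M ↔ ∀ u ≥ M, m u v = 0 := by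
  have h1 : NeighborsLt e v M ↔ d v = m v v + ∑ u ∈ Finset.range M, m u v := by
    constructor
    · rintro ⟨c, h0, hs, hd⟩
      rw [h.deg, Part.mem_some_iff] at hd
      rw [h.multIs_iff] at h0
      rw [← hd]
      clear hd
      induction M with
      | zero => simpa using h0
      | succ M ih =>
        obtain ⟨k, hk, hc⟩ := hs M M.lt_succ_self
        rw [h.multIs_iff] at hk
        rw [hc, ih fun u hu => hs u (by omega), Finset.sum_range_succ, hk, add_assoc]
    · intro hd
      obtain ⟨c, hc⟩ := exists_entry_eq (M + 1) fun i => m v v + ∑ u ∈ Finset.range i, m u v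
      refine ⟨c, ?_, fun u hu => ⟨m u v, h.multIs_iff.2 rfl, ?_⟩, ?_⟩
      · rw [h.multIs_iff, hc 0 (by omega)]; simp
      · rw [hc _ (by omega), hc _ (by omega), Finset.sum_range_succ, add_assoc]
      · rw [h.deg, Part.mem_some_iff, hc _ (by omega), hd]
  rw [h1]
  refine ⟨fun hd u hu => ?_, h.deg_eq v M⟩
  obtain ⟨K, hK⟩ := h.isMultiplicity.bound v
  have h2 := h.deg_eq v (max (u + 1) K) fun w hw => hK w (by omega)
  have h3 := Finset.sum_range_add_sum_Ico (fun u => m u v) (m := M) (n := max (u + 1) K) (by omega)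
  have h4 : ∑ w ∈ Finset.Ico M (max (u + 1) K), m w v = 0 := by omega
  exact Finset.sum_eq_zero_iff.1 h4 u (by simp; omega)

lemma linkIs_iff (h : Presents e V m d) {l x y : ℕ} :
    LinkIs e l x y ↔ (canonicalGraph V m).IsLink l x y := by
  simp only [LinkIs, h.multIs_iff, exists_eq_left, h.isMultiplicity.isLink_iff]

lemma adjIs_iff (h : Presents e V m d) {n c x y : ℕ} :
    AdjIs e n c x y ↔ AdjAvoiding (canonicalGraph V m) n (entry c) x y := by
  simp only [AdjIs, AdjAvoiding, h.linkIs_iff]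

lemma saturated_iff (h : Presents e V m d) {n c v : ℕ} :
    Saturated e n c v ↔
      ∀ l x, (canonicalGraph V m).IsLink l v x → ∃ j < n, entry c j = l := by
  have hm := h.isMultiplicity
  simp only [Saturated, h.neighborsLt_iff, h.multIs_iff, exists_eq_left]
  constructor
  · rintro ⟨M, hM, hs⟩ l x hl
    obtain ⟨i, hi, rfl⟩ := hm.isLink_iff.1 hl.symm
    have hx : x < M := by
      by_contra hx
      have := hM x (by omega)
      omega
    exact hs x hx i hi |>.imp fun j hj => ⟨hj.1, hj.2⟩
  · intro hs
    obtain ⟨M, hM⟩ := hm.bound v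
    refine ⟨M, hM, fun u _ i hi => hs _ u ?_⟩
    exact (hm.isLink_iff.2 ⟨i, hi, rfl⟩).symm

lemma trailIs_iff (h : Presents e V m d) {n b c : ℕ} :
    TrailIs e n b c ↔ IsExtendableTrail (canonicalGraph V m) n (entry b) (entry c) := by
  have hadj : AdjIs e n c = AdjAvoiding (canonicalGraph V m) n (entry c) := by
    ext x y; exact h.adjIs_iff
  simp only [TrailIs, hadj, h.linkIs_iff, h.saturated_iff]
  exact ⟨fun ⟨h1, h2, h3, h4, h5⟩ => ⟨h1, h2, h3, h4, h5⟩,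
    fun ⟨h1, h2, h3, h4, h5⟩ => ⟨h1, h2, h3, h4, h5⟩⟩

end Presents

lemma IsExtendableTrail.congr {G : Graph ℕ ℕ} {n : ℕ} {w ε w' ε' : ℕ → ℕ}
    (h : IsExtendableTrail G n w ε) (hw : ∀ i < n + 1, w' i = w i) (hε : ∀ i < n, ε' i = ε i) :
    IsExtendableTrail G n w' ε' := by
  have hadj : AdjAvoiding G n ε' = AdjAvoiding G n ε := by
    ext x y
    refine exists_congr fun e => and_congr_right fun _ => forall₂_congr fun i hi => ?_
    rw [hε i hi]
  refine ⟨fun i hi => ?_, fun i hi j hj => ?_, ?_, ?_, fun i hi => ?_⟩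
  · rw [hε i hi, hw i (by omega), hw (i + 1) (by omega)]
    exact h.link i hi
  · rw [hε i hi, hε j (by omega)]
    exact h.ne i hi j hj
  · rw [hadj, hw 0 (by omega)]
    exact h.left
  · rw [hadj, hw n (by omega)]
    exact h.right
  · rw [hadj, hw 0 (by omega), hw n (by omega), hw i hi]
    refine (h.reach i hi).imp_left fun hs e x hx => ?_
    obtain ⟨j, hj, rfl⟩ := hs e x hx
    exact ⟨j, hj, hε j hj⟩

/-- One side bounds labels, the other bounds ends and ranks. The triples below `N` have finitely
many labels, and a label is at least as large as its components. -/
lemma Presents.hasExtendableTrails_iff {e : ℕ} {V : Set ℕ} {m : ℕ → ℕ → ℕ} {d : ℕ → ℕ}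
    (h : Presents e V m d) : HasExtendableTrails (canonicalGraph V m) ↔
      ∀ N, ∃ n b c, TrailIs e n b c ∧ CoversLt e n c N := by
  have hm := h.isMultiplicity
  simp only [h.trailIs_iff, CoversLt, h.multIs_iff, exists_eq_left]
  constructor
  · intro hG N
    obtain ⟨n, w, ε, ht, hc⟩ := hG
      ((Finset.range N ×ˢ Finset.range N ×ˢ Finset.range N).sup
        (fun p => edgeLabel p.1 p.2.1 p.2.2) + 1)
    obtain ⟨b, hb⟩ := exists_entry_eq (n + 1) w
    obtain ⟨c, hc'⟩ := exists_entry_eq n ε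
    refine ⟨n, b, c, ht.congr hb hc', fun u hu v hv i hi => ?_⟩
    rw [or_iff_not_imp_left]
    intro hi'
    obtain ⟨j, hj, hj'⟩ := hc (edgeLabel u v i) (Nat.lt_succ_of_le
      (Finset.le_sup (f := fun p : ℕ × ℕ × ℕ => edgeLabel p.1 p.2.1 p.2.2) (b := (u, v, i))
      (by simp [hu, hv, hi]))) (hm.isLink_iff.2 ⟨i, by omega, rfl⟩ :
        (canonicalGraph V m).IsLink _ u v).edge_mem
    exact ⟨j, hj, (hc' j hj).trans hj'⟩
  · intro hG N
    obtain ⟨n, b, c, ht, hc⟩ := hG N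
    refine ⟨n, _, _, ht, fun l hl hlG => ?_⟩
    obtain ⟨u, v, huv⟩ := Graph.exists_isLink_of_mem_edgeSet hlG
    obtain ⟨i, hi, rfl⟩ := hm.isLink_iff.1 huv
    have h1 := (Nat.left_le_pair (Nat.pair (min u v) (max u v)) i).trans_lt hl
    have h2 := (Nat.right_le_pair (Nat.pair (min u v) (max u v)) i).trans_lt hl
    have h3 := (Nat.left_le_pair (min u v) (max u v)).trans_lt h1
    have h4 := (Nat.right_le_pair (min u v) (max u v)).trans_lt h1
    exact (hc u (by omega) v (by omega) i h2).resolve_left (by omega)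

/-- That `e` is an index is not presupposed: the clauses for all `u` and `v` make the programs total
and their values those of a locally finite multigraph, which is then realized canonically. -/
lemma mem_twoWayEulerianProblem_iff (e : ℕ) :
    e ∈ TwoWayEulerianProblem ↔ ∀ u v, ProblemMatrix e u v := by
  constructor
  · rintro ⟨G, hG, hconn, hpath⟩ u v
    have h := hG.presents
    have hm := h.isMultiplicity
    have hc := hG.1.connected_canonicalGraph hconn
    have hp := hG.1.hasTwoWayEulerianPath_canonicalGraph hpath
    refine ⟨?_, ⟨_, h.multIs_iff.2 rfl, h.multIs_iff.2 (hm.symm u v)⟩, ?_, ?_, ?_, ?_,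
      h.hasExtendableTrails_iff.1 hp.hasExtendableTrails u⟩
    · rw [h.vertIs_zero_iff, h.vertIs_one_iff]
      exact (em _).symm
    · rw [h.multIs_iff, h.vertIs_one_iff, or_iff_not_imp_left]
      exact fun h' => hm.mem u v (Ne.symm h')
    · obtain ⟨M, hM⟩ := hm.bound u
      exact ⟨max v M, le_max_left _ _, h.neighborsLt_iff.2 fun w hw => hM w (by omega)⟩
    · obtain ⟨x, hx⟩ := hconn.1
      exact ⟨x, h.vertIs_one_iff.2 hx⟩
    · rw [h.vertIs_zero_iff, h.vertIs_zero_iff]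
      by_cases hu : u ∈ G.vertexSet
      · by_cases hv : v ∈ G.vertexSet
        · refine Or.inr (Or.inr (Relation.ReflTransGen.mono ?_ _ _ (hconn.2 u hu v hv)))
          rintro x y ⟨l, hl⟩
          have := hG.1.edgeMultiplicity_ne_zero.2 ⟨l, hl⟩
          exact ⟨edgeMultiplicity G x y - 1, h.multIs_iff.2 (by omega)⟩
        · exact Or.inr (Or.inl hv)
      · exact Or.inl hu
  · intro h
    choose m hm₁ hm₂ using fun u v => (h u v).2.1
    have hmult : ∀ u v k, MultIs e u v k ↔ k = m u v := fun u v k =>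
      ⟨fun hk => Part.mem_unique hk (hm₁ u v), fun hk => hk ▸ hm₁ u v⟩
    have hdeg : ∀ v, ∃ k, k ∈ phi e.unpair.2.unpair.2 v := by
      intro v
      obtain ⟨M, -, c, -, -, hc⟩ := (h v 0).2.2.2.1
      exact ⟨_, hc⟩
    choose d hd using hdeg
    have hN : ∀ v M, NeighborsLt e v M → d v = m v v + ∑ u ∈ Finset.range M, m u v := by
      rintro v M ⟨c, h0, hs, hc⟩
      rw [Part.mem_unique (hd v) hc]
      rw [hmult] at h0
      clear hc
      induction M with
      | zero => simpa using h0
      | succ M ih =>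
        obtain ⟨k, hk, hc⟩ := hs M M.lt_succ_self
        rw [hmult] at hk
        rw [hc, ih fun u hu => hs u (by omega), Finset.sum_range_succ, hk, add_assoc]
    -- There is a bound `K > u` whose partial sum is the degree too, so the terms between `M` and
    -- `K` vanish.
    have hbound : ∀ v M, NeighborsLt e v M → ∀ u ≥ M, m u v = 0 := by
      intro v M hM u hu
      obtain ⟨K, hK, hK'⟩ := (h v (u + 1)).2.2.2.1
      have h1 := hN v M hM
      have h2 := hN v K hK'
      have h3 := Finset.sum_range_add_sum_Ico (fun u => m u v) (m := M) (n := K) (by omega)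
      have h4 : ∑ w ∈ Finset.Ico M K, m w v = 0 := by omega
      exact Finset.sum_eq_zero_iff.1 h4 u (by simp; omega)
    have hP : Presents e {v | VertIs e v 1} m d := by
      refine ⟨fun v => ?_, fun u v => Part.eq_some_iff.2 (hm₁ u v),
        fun v => Part.eq_some_iff.2 (hd v), ⟨fun u v => ?_, fun u v huv => ?_, fun v => ?_⟩,
        fun v M hM => ?_⟩
      · rw [Part.eq_some_iff]
        split_ifs with hv
        · exact hv
        · exact (h v v).1.resolve_right hv
      · exact Part.mem_unique (hm₁ u v) (hm₂ v u)
      · exact (h u v).2.2.1.resolve_left fun h0 => huv ((hmult u v 0).1 h0).symm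
      · obtain ⟨M, -, hM⟩ := (h v 0).2.2.2.1
        exact ⟨M, hbound v M hM⟩
      · obtain ⟨K, hMK, hK⟩ := (h v M).2.2.2.1
        rw [hN v K hK, ← Finset.sum_range_add_sum_Ico (fun u => m u v) hMK,
          Finset.sum_eq_zero (s := Finset.Ico M K) fun u hu => hM u (Finset.mem_Ico.1 hu).1,
          add_zero]
    refine ⟨canonicalGraph {v | VertIs e v 1} m, hP.isIndex, ⟨(h 0 0).2.2.2.2.1, ?_⟩, ?_⟩
    · intro u hu v hv
      rcases (h u v).2.2.2.2.2.1 with h0 | h0 | hr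
      · exact absurd hu (hP.vertIs_zero_iff.1 h0)
      · exact absurd hv (hP.vertIs_zero_iff.1 h0)
      · refine Relation.ReflTransGen.mono ?_ _ _ hr
        rintro x y ⟨k, hk⟩
        rw [hmult] at hk
        exact ⟨edgeLabel x y 0, hP.isMultiplicity.isLink_iff.2 ⟨0, by omega, rfl⟩⟩
    · exact HasExtendableTrails.hasTwoWayEulerianPath hP.isMultiplicity.isLocallyFinite
        (hP.hasExtendableTrails_iff.2 fun N => (h N 0).2.2.2.2.2.2)

theorem isPi02_twoWayEulerianProblem : IsPi02 TwoWayEulerianProblem := by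
  refine isPi02_of_forall (p := fun e y => ProblemMatrix e y.unpair.1 y.unpair.2)
    (isSemidecidable_problemMatrix (by fun_prop) (by fun_prop) (by fun_prop)) fun e => ?_
  rw [mem_twoWayEulerianProblem_iff]
  exact ⟨fun h y => h _ _, fun h u v => by simpa using h (Nat.pair u v)⟩

/-! ## Ladders -/

open Classical in
/-- The number of edges between `u` and `v` in the ladder with set of rungs `R`: consecutive
vertices on each of the rays `0, 2, 4, …` and `1, 3, 5, …` are joined by two edges, and so are
`2 * k` and `2 * k + 1` for `k ∈ R`. -/
noncomputable def ladderMult (R : Set ℕ) (u v : ℕ) : ℕ :=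
  if u = v + 2 ∨ v = u + 2 ∨ (u ≠ v ∧ u / 2 = v / 2 ∧ u / 2 ∈ R) then 2 else 0

/-- The ladder with set of rungs `R`. -/
noncomputable def ladder (R : Set ℕ) : Graph ℕ ℕ := canonicalGraph Set.univ (ladderMult R)

section Ladder

variable {R : Set ℕ}

lemma ladderMult_eq_two_or (R : Set ℕ) (u v : ℕ) : ladderMult R u v = 2 ∨ ladderMult R u v = 0 := by
  unfold ladderMult; split_ifs <;> simp

lemma ladderMult_pos_iff {u v : ℕ} : 0 < ladderMult R u v ↔
    u = v + 2 ∨ v = u + 2 ∨ (u ≠ v ∧ u / 2 = v / 2 ∧ u / 2 ∈ R) := by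
  unfold ladderMult; split_ifs with h <;> simp [h]

lemma isMultiplicity_ladderMult (R : Set ℕ) : IsMultiplicity Set.univ (ladderMult R) where
  symm u v := by
    have h1 := ladderMult_eq_two_or R u v
    have h2 := ladderMult_eq_two_or R v u
    have h3 : 0 < ladderMult R u v ↔ 0 < ladderMult R v u := by
      rw [ladderMult_pos_iff, ladderMult_pos_iff]
      constructor <;>
      · rintro (h | h | ⟨h1, h2, h3⟩)
        · exact Or.inr (Or.inl h)
        · exact Or.inl h
        · exact Or.inr (Or.inr ⟨h1.symm, h2.symm, h2 ▸ h3⟩)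
    omega
  mem _ _ _ := trivial
  bound v := by
    refine ⟨v + 3, fun u hu => Nat.eq_zero_of_not_pos fun h => ?_⟩
    rcases ladderMult_pos_iff.1 h with h | h | ⟨-, h, -⟩ <;> omega

lemma ladderMult_eq_zero_of_le {u v : ℕ} (hu : v + 3 ≤ u) : ladderMult R u v = 0 := by
  refine Nat.eq_zero_of_not_pos fun h => ?_
  rcases ladderMult_pos_iff.1 h with h | h | ⟨-, h, -⟩ <;> omega

lemma ladder_isLink_iff {e u v : ℕ} :
    (ladder R).IsLink e u v ↔ 0 < ladderMult R u v ∧ ∃ i < 2, e = edgeLabel u v i := by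
  rw [ladder, (isMultiplicity_ladderMult R).isLink_iff]
  rcases ladderMult_eq_two_or R u v with h | h <;> simp [h]

lemma ladder_isLink_ray (u i : ℕ) (hi : i < 2) :
    (ladder R).IsLink (edgeLabel u (u + 2) i) u (u + 2) :=
  ladder_isLink_iff.2 ⟨ladderMult_pos_iff.2 (by simp), i, hi, rfl⟩

lemma ladder_isLink_rung {k i : ℕ} (hk : k ∈ R) (hi : i < 2) :
    (ladder R).IsLink (edgeLabel (2 * k) (2 * k + 1) i) (2 * k) (2 * k + 1) := by
  refine ladder_isLink_iff.2 ⟨ladderMult_pos_iff.2 (Or.inr (Or.inr ⟨by omega, by omega, ?_⟩)),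
    i, hi, rfl⟩
  rwa [Nat.mul_div_cancel_left k (by omega)]

lemma isLocallyFinite_ladder (R : Set ℕ) : IsLocallyFinite (ladder R) :=
  (isMultiplicity_ladderMult R).isLocallyFinite

lemma connected_ladder (h0 : 0 ∈ R) : Connected (ladder R) := by
  have h : ∀ v, Relation.ReflTransGen (ladder R).Adj 0 v := by
    intro v
    induction v using Nat.strong_induction_on with
    | _ v ih =>
      rcases v with _ | _ | v
      · exact .refl
      · exact .single ⟨_, ladder_isLink_rung h0 zero_lt_two⟩
      · exact (ih v (by omega)).tail ⟨_, ladder_isLink_ray v 0 zero_lt_two⟩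
  have : Std.Symm (ladder R).Adj := ⟨fun _ _ ⟨e, he⟩ => ⟨e, he.symm⟩⟩
  exact ⟨⟨0, trivial⟩, fun u _ v _ => (Relation.ReflTransGen.stdSymm.symm _ _ (h u)).trans (h v)⟩

/-- The first end of an edge, read off from its label. -/
def labelFst (e : ℕ) : ℕ := e.unpair.1.unpair.1

/-- The second end of an edge, read off from its label. -/
def labelSnd (e : ℕ) : ℕ := e.unpair.1.unpair.2

lemma joins_edgeLabel (u v i : ℕ) : Joins labelFst labelSnd (edgeLabel u v i) u v := by
  simp only [Joins, labelFst, labelSnd, edgeLabel, Nat.unpair_pair]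
  omega

/-- The edge parallel to a given one. -/
def swapLabel (e : ℕ) : ℕ := Nat.pair e.unpair.1 (1 - e.unpair.2)

lemma swapLabel_edgeLabel (u v i : ℕ) : swapLabel (edgeLabel u v i) = edgeLabel u v (1 - i) := by
  simp [swapLabel, edgeLabel]

lemma boundary_swapLabel (e : ℕ) :
    boundary labelFst labelSnd (swapLabel e) = boundary labelFst labelSnd e := by
  simp [boundary, labelFst, labelSnd, swapLabel]

lemma IsWalk.visited_length {E V : Type*} {s t : E → V} {x y : V} {l : List (E × V)}
    (h : IsWalk s t x l y) (g : ℕ → E × V) (hg : ∀ i < l.length, l[i]? = some (g i)) :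
    visited x g l.length = y := by
  induction l generalizing x g with
  | nil => exact h
  | cons p l ih =>
    have h0 : p = g 0 := by simpa using hg 0 (by simp)
    have := ih h.2 (fun j => g (j + 1)) fun j hj => by simpa using hg (j + 1) (by simpa using hj)
    rw [← this, List.length_cons]
    cases l with
    | nil => simp [visited, h0]
    | cons q l => rfl

/-- The edges of the ladder between vertices up to `2 * K + 1`. -/
noncomputable def ladderSegment (R : Set ℕ) (K : ℕ) : Finset ℕ :=
  (Finset.range (2 * K + 2)).biUnion fun u => (Finset.range (2 * K + 2)).biUnion fun v =>
    (Finset.range (ladderMult R u v)).image (edgeLabel u v)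

lemma mem_ladderSegment {K e : ℕ} : e ∈ ladderSegment R K ↔
    ∃ u < 2 * K + 2, ∃ v < 2 * K + 2, 0 < ladderMult R u v ∧ ∃ i < 2, e = edgeLabel u v i := by
  simp only [ladderSegment, Finset.mem_biUnion, Finset.mem_range, Finset.mem_image]
  refine exists_congr fun u => and_congr_right fun _ => exists_congr fun v =>
    and_congr_right fun _ => ?_
  rcases ladderMult_eq_two_or R u v with h | h <;> simp [h, eq_comm]

lemma isLink_of_mem_ladderSegment {K e : ℕ} (he : e ∈ ladderSegment R K) :
    ∃ u < 2 * K + 2, ∃ v < 2 * K + 2, (ladder R).IsLink e u v := by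
  obtain ⟨u, hu, v, hv, h⟩ := mem_ladderSegment.1 he
  exact ⟨u, hu, v, hv, ladder_isLink_iff.2 h⟩

lemma mem_ladderSegment_iff_of_isLink {K e u v : ℕ} (h : (ladder R).IsLink e u v) :
    e ∈ ladderSegment R K ↔ u < 2 * K + 2 ∧ v < 2 * K + 2 := by
  constructor
  · intro he
    obtain ⟨u', hu', v', hv', h'⟩ := isLink_of_mem_ladderSegment he
    rcases h.eq_and_eq_or_eq_and_eq h' with ⟨rfl, rfl⟩ | ⟨rfl, rfl⟩ <;> exact ⟨‹_›, ‹_›⟩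
  · rintro ⟨hu, hv⟩
    exact mem_ladderSegment.2 ⟨u, hu, v, hv, ladder_isLink_iff.1 h⟩

/-- Parallel edges cancel in pairs, so the boundary is zero; the rung at `K` connects the two rays
inside the segment. -/
lemma exists_eulerian_circuit_ladderSegment {K : ℕ} (hK : K ∈ R) :
    ∃ l, IsWalk labelFst labelSnd (2 * K) l (2 * K) ∧ (edges l).Nodup ∧
      ∀ e, e ∈ edges l ↔ e ∈ ladderSegment R K := by
  apply exists_eulerian_trail
  · rw [pi_add_self]
    refine Finset.sum_involution (fun e _ => swapLabel e) ?_ ?_ ?_ ?_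
    · intro e _
      rw [boundary_swapLabel, pi_add_self]
    · intro e he _ h
      obtain ⟨u, -, v, -, -, i, hi, rfl⟩ := mem_ladderSegment.1 he
      rw [swapLabel_edgeLabel] at h
      have := (edgeLabel_inj h).2
      omega
    · intro e he
      obtain ⟨u, hu, v, hv, h, i, hi, rfl⟩ := mem_ladderSegment.1 he
      rw [swapLabel_edgeLabel]
      exact mem_ladderSegment.2 ⟨u, hu, v, hv, h, 1 - i, by omega, rfl⟩
    · intro e he
      obtain ⟨u, hu, v, hv, h, i, hi, rfl⟩ := mem_ladderSegment.1 he
      rw [swapLabel_edgeLabel, swapLabel_edgeLabel]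
      congr 1
      omega
  -- Descend both rays from the top in steps of two; `d` is the distance of `v` from the top vertex
  -- `2 * K + 1`.
  · have key : ∀ d v, v + d = 2 * K + 1 →
        ReachIn labelFst labelSnd (ladderSegment R K : Set ℕ) (2 * K) v := by
      intro d
      induction d using Nat.strong_induction_on with
      | _ d ih =>
        intro v hv
        rcases d with _ | _ | d
        · obtain rfl : v = 2 * K + 1 := by omega
          exact .single ⟨_, (mem_ladderSegment_iff_of_isLink
            (ladder_isLink_rung hK zero_lt_two)).2 (by omega), joins_edgeLabel _ _ _⟩
        · obtain rfl : v = 2 * K := by omega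
          exact .refl
        · exact (ih d (by omega) (v + 2) (by omega)).tail ⟨_, (mem_ladderSegment_iff_of_isLink
            (ladder_isLink_ray v 0 zero_lt_two)).2 (by omega), (joins_edgeLabel _ _ _).symm⟩
    intro e he
    obtain ⟨u, hu, v, hv, h, i, hi, rfl⟩ := mem_ladderSegment.1 he
    rcases joins_edgeLabel u v i with h | h
    · exact key (2 * K + 1 - u) _ (by omega)
    · exact key (2 * K + 1 - v) _ (by omega)

/-- In the segment up to a rung `K`, only `2 * K` and `2 * K + 1` have further edges. The circuit
starts and ends at the former; the latter is reached by climbing the even ray to a later rung `K'`,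
crossing it and descending. -/
lemma hasExtendableTrails_ladder (hR : R.Infinite) : HasExtendableTrails (ladder R) := by
  intro N
  obtain ⟨K, hK, hNK⟩ := hR.exists_gt N
  obtain ⟨K', hK', hKK'⟩ := hR.exists_gt K
  obtain ⟨l, hl, hnd, hlS⟩ := exists_eulerian_circuit_ladderSegment hK
  let g : ℕ → ℕ × ℕ := fun i => l.getD i (0, 0)
  have hg : ∀ i < l.length, l[i]? = some (g i) := by
    intro i hi
    simp [g, hi]
  have hε : ∀ i < l.length, (edges l)[i]? = some (g i).1 := by
    intro i hi
    simp [edges, hg i hi]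
  have hmem : ∀ e, (∃ i < l.length, (g i).1 = e) ↔ e ∈ ladderSegment R K := by
    intro e
    rw [← hlS, List.mem_iff_getElem?]
    constructor
    · rintro ⟨i, hi, rfl⟩
      exact ⟨i, hε i hi⟩
    · rintro ⟨i, hi⟩
      have hi' : i < l.length := by
        rw [← length_edges]
        exact (List.getElem?_eq_some_iff.1 hi).1
      rw [hε i hi'] at hi
      exact ⟨i, hi', Option.some.inj hi⟩
  have hlink : ∀ i < l.length, (ladder R).IsLink (g i).1 (visited (2 * K) g i)
      (visited (2 * K) g (i + 1)) := by
    intro i hi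
    have hj := hl.joins_visited g hg i hi
    obtain ⟨u, -, v, -, h, k, hk, he⟩ := mem_ladderSegment.1 ((hmem _).1 ⟨i, hi, rfl⟩)
    rw [he] at hj ⊢
    have h1 : (ladder R).IsLink (edgeLabel u v k) u v := ladder_isLink_iff.2 ⟨h, k, hk, rfl⟩
    rcases joins_edgeLabel u v k with ⟨h2, h3⟩ | ⟨h2, h3⟩ <;>
      rcases hj with ⟨h4, h5⟩ | ⟨h4, h5⟩ <;> rw [← h4, ← h5, h2, h3] <;>
      first | exact h1 | exact h1.symm
  have hbound : ∀ i < l.length + 1, visited (2 * K) g i < 2 * K + 2 := by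
    rintro (_ | i) hi
    · simp [visited]
    · have h := hlink i (by omega)
      exact ((mem_ladderSegment_iff_of_isLink h).1 ((hmem _).1 ⟨i, by omega, rfl⟩)).2
  have hadj : ∀ {e u v}, (ladder R).IsLink e u v → (2 * K + 2 ≤ u ∨ 2 * K + 2 ≤ v) →
      AdjAvoiding (ladder R) l.length (fun i => (g i).1) u v := by
    intro e u v h huv
    refine ⟨e, h, fun i hi hie => ?_⟩
    have := (mem_ladderSegment_iff_of_isLink h).1 ((hmem _).1 ⟨i, hi, hie⟩)
    omega
  have hup : ∀ a, 2 * K ≤ a → ∀ d, Relation.ReflTransGen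
      (AdjAvoiding (ladder R) l.length (fun i => (g i).1)) a (a + 2 * d) := by
    intro a ha d
    induction d with
    | zero => exact .refl
    | succ d ih => exact ih.tail (hadj (ladder_isLink_ray (a + 2 * d) 0 zero_lt_two) (by omega))
  have hdown : ∀ a, 2 * K ≤ a → ∀ d, Relation.ReflTransGen
      (AdjAvoiding (ladder R) l.length (fun i => (g i).1)) (a + 2 * d) a := by
    intro a ha d
    induction d with
    | zero => exact .refl
    | succ d ih =>
      exact .head (hadj (ladder_isLink_ray (a + 2 * d) 0 zero_lt_two).symm (by omega)) ih
  have hend := hl.visited_length g hg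
  have hout : AdjAvoiding (ladder R) l.length (fun i => (g i).1) (2 * K) (2 * K + 2) :=
    hadj (ladder_isLink_ray (2 * K) 0 zero_lt_two) (by omega)
  refine ⟨l.length, visited (2 * K) g, fun i => (g i).1, ⟨hlink, ?_, ⟨_, hout⟩, ?_, ?_⟩, ?_⟩
  · intro i hi j hj hij
    have h1 := hε i hi
    have h2 := hε j (by omega)
    have := (List.getElem?_inj (List.getElem?_eq_some_iff.1 h1).1 hnd).1
      (h1.trans ((congrArg some hij).trans h2.symm))
    omega
  · rw [hend]
    exact ⟨_, hout⟩
  · intro i hi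
    have hb := hbound i hi
    have h0 : visited (2 * K) g 0 = 2 * K := rfl
    rw [hend, h0]
    generalize visited (2 * K) g i = v at hb
    rcases lt_trichotomy v (2 * K) with hv | rfl | hv
    · refine Or.inl fun e x hx => (hmem e).2 ((mem_ladderSegment_iff_of_isLink hx).2 ⟨hb, ?_⟩)
      rcases ladderMult_pos_iff.1 (ladder_isLink_iff.1 hx).1 with h | h | ⟨-, h, -⟩ <;> omega
    · exact Or.inr (Or.inl .refl)
    · obtain rfl : v = 2 * K + 1 := by omega
      obtain ⟨d, rfl⟩ := Nat.exists_eq_add_of_lt hKK'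
      have h1 := hup (2 * K) le_rfl (d + 1)
      have h2 := hdown (2 * K + 1) (by omega) (d + 1)
      refine Or.inr (Or.inl (h1.trans (.head ?_ h2)))
      convert hadj (ladder_isLink_rung hK' zero_lt_two) (by omega) using 1 <;> ring
  · intro e he heG
    obtain ⟨u, v, h⟩ := Graph.exists_isLink_of_mem_edgeSet heG
    refine (hmem e).2 ((mem_ladderSegment_iff_of_isLink h).2 ?_)
    obtain ⟨-, i, -, rfl⟩ := ladder_isLink_iff.1 h
    have h1 := (Nat.left_le_pair (Nat.pair (min u v) (max u v)) i).trans_lt he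
    have h2 := (Nat.left_le_pair (min u v) (max u v)).trans_lt h1
    have h3 := (Nat.right_le_pair (min u v) (max u v)).trans_lt h1
    omega

/-- After all rungs are used, unused edges stay on one side, and both ends of the trail are on the
same side because rungs are doubled. The largest vertex of the trail on the other side is then
reached from neither end, and it is not saturated, since its edges to the next vertex up its ray are
unused. -/
lemma not_hasExtendableTrails_ladder (h0 : 0 ∈ R) (hR : R.Finite) :
    ¬ HasExtendableTrails (ladder R) := by
  intro hG
  obtain ⟨B, hB⟩ := hR.bddAbove
  obtain ⟨n, w, ε, ht, hc⟩ := hG ((Finset.range (B + 1) ×ˢ Finset.range 2).sup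
    (fun p => edgeLabel (2 * p.1) (2 * p.1 + 1) p.2) + 1)
  have hrung : ∀ k ∈ R, ∀ i < 2, ∃ j < n, ε j = edgeLabel (2 * k) (2 * k + 1) i := by
    intro k hk i hi
    refine hc _ (Nat.lt_succ_of_le (Finset.le_sup
      (f := fun p : ℕ × ℕ => edgeLabel (2 * p.1) (2 * p.1 + 1) p.2) (b := (k, i)) ?_))
      (ladder_isLink_rung hk hi).edge_mem
    simpa using ⟨hB hk, Nat.le_of_lt_succ hi⟩
  -- edges that change the side of the ladder are rungs
  have hside : ∀ {e u v}, (ladder R).IsLink e u v → u % 2 ≠ v % 2 →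
      ∃ k ∈ R, ∃ i < 2, e = edgeLabel (2 * k) (2 * k + 1) i := by
    intro e u v h huv
    obtain ⟨h1, i, hi, rfl⟩ := ladder_isLink_iff.1 h
    rcases ladderMult_pos_iff.1 h1 with h1 | h1 | ⟨-, h2, h3⟩
    · omega
    · omega
    · refine ⟨u / 2, h3, i, hi, ?_⟩
      rcases Nat.mod_two_eq_zero_or_one u with hu | hu
      · congr 1 <;> omega
      · rw [edgeLabel_comm]
        congr 1 <;> omega
  have hreach : ∀ {x y}, Relation.ReflTransGen (AdjAvoiding (ladder R) n ε) x y →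
      x % 2 = y % 2 := by
    intro x y h
    induction h with
    | refl => rfl
    | tail _ hadj ih =>
      obtain ⟨e, he, hne⟩ := hadj
      by_contra hxy
      obtain ⟨k, hk, i, hi, rfl⟩ := hside he (by omega)
      obtain ⟨j, hj, hj'⟩ := hrung k hk i hi
      exact hne j hj hj'
  -- both ends of the trail are on the same side
  have hends : w 0 % 2 = w n % 2 := by
    -- On edges of the ladder, `f` is one exactly at rungs, and its sum along the trail telescopes.
    let f : ℕ → ZMod 2 := fun e => labelFst e + labelSnd e
    have hf : ∀ e u v i, e = edgeLabel u v i → f e = u + v := by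
      rintro _ u v i rfl
      rcases joins_edgeLabel u v i with ⟨h1, h2⟩ | ⟨h1, h2⟩
      · simp only [f, h1, h2]
      · simp only [f, h1, h2, add_comm]
    have hfl : ∀ {e u v}, (ladder R).IsLink e u v → f e = u + v := by
      intro e u v h
      obtain ⟨-, i, -, he⟩ := ladder_isLink_iff.1 h
      exact hf _ _ _ _ he
    have hsum : ∀ m ≤ n, ∑ i ∈ Finset.range m, f (ε i) = w 0 + w m := by
      intro m hm
      induction m with
      | zero => simpa using (CharTwo.add_self_eq_zero _).symm
      | succ m ih =>
        rw [Finset.sum_range_succ, ih (by omega), hfl (ht.link m (by omega))]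
        rw [add_assoc, ← add_assoc (w m : ZMod 2), CharTwo.add_self_eq_zero, zero_add]
    -- All rung edges are in the trail, so the nonzero terms cancel in parallel pairs.
    have hzero : ∑ e ∈ (Finset.range n).image ε, f e = 0 := by
      have hne : ∀ e ∈ (Finset.range n).image ε, f e ≠ 0 →
          ∃ k ∈ R, ∃ i < 2, e = edgeLabel (2 * k) (2 * k + 1) i := by
        intro e he hfe
        obtain ⟨j, hj, rfl⟩ := Finset.mem_image.1 he
        have hl := ht.link j (Finset.mem_range.1 hj)
        refine hside hl fun hmod => hfe ?_
        rw [hfl hl, (ZMod.natCast_eq_natCast_iff' _ _ 2).2 hmod, CharTwo.add_self_eq_zero]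
      refine Finset.sum_involution (fun e _ => if f e = 0 then e else swapLabel e) ?_ ?_ ?_ ?_
      · intro e he
        split_ifs with h
        · rw [h, add_zero]
        · obtain ⟨k, -, i, -, rfl⟩ := hne e he h
          rw [swapLabel_edgeLabel, hf _ _ _ _ rfl, hf _ _ _ _ rfl, CharTwo.add_self_eq_zero]
      · intro e he h
        simp only [h, if_false]
        obtain ⟨k, -, i, hi, rfl⟩ := hne e he h
        rw [swapLabel_edgeLabel]
        intro h
        have := (edgeLabel_inj h).2
        omega
      · intro e he
        split_ifs with h
        · exact he
        · obtain ⟨k, hk, i, -, rfl⟩ := hne e he h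
          rw [swapLabel_edgeLabel]
          obtain ⟨j, hj, hj'⟩ := hrung k hk (1 - i) (by omega)
          exact Finset.mem_image.2 ⟨j, Finset.mem_range.2 hj, hj'⟩
      · intro e he
        by_cases h : f e = 0
        · simp [h]
        · obtain ⟨k, -, i, hi, rfl⟩ := hne e he h
          have h' : f (edgeLabel (2 * k) (2 * k + 1) (1 - i)) ≠ 0 := by
            rwa [hf _ _ _ _ rfl, ← hf _ _ _ i rfl]
          rw [if_neg h, swapLabel_edgeLabel, if_neg h', swapLabel_edgeLabel]
          congr 1
          omega
    rw [Finset.sum_image ht.injOn, hsum n le_rfl] at hzero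
    exact (ZMod.natCast_eq_natCast_iff' _ _ 2).1 (CharTwo.add_eq_zero.1 hzero)
  -- a maximal vertex of the trail on the other side
  obtain ⟨j, hj, hmax⟩ := Finset.exists_max_image
    ((Finset.range (n + 1)).filter fun j => w j % 2 ≠ w 0 % 2) w (by
      -- The rung at `0` is in the trail, so the trail visits both sides.
      obtain ⟨i, hi, he⟩ := hrung 0 h0 0 zero_lt_two
      have hl := ht.link i hi
      rw [he] at hl
      rcases hl.eq_and_eq_or_eq_and_eq (ladder_isLink_rung h0 zero_lt_two) with ⟨h1, h2⟩ | ⟨h1, h2⟩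
      all_goals
        by_cases h3 : w i % 2 = w 0 % 2
        · exact ⟨i + 1, by simp; omega⟩
        · exact ⟨i, by simp; omega⟩)
  simp only [Finset.mem_filter, Finset.mem_range] at hj hmax
  rcases ht.reach j hj.1 with h | h | h
  · obtain ⟨i, hi, he⟩ := h _ _ (ladder_isLink_ray (w j) 0 zero_lt_two)
    have hl := ht.link i hi
    rw [he] at hl
    rcases hl.eq_and_eq_or_eq_and_eq (ladder_isLink_ray (w j) 0 zero_lt_two) with
      ⟨h1, h2⟩ | ⟨h1, h2⟩
    · have := hmax (i + 1) ⟨by omega, by omega⟩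
      omega
    · have := hmax i ⟨by omega, by omega⟩
      omega
  · exact hj.2 (hreach h).symm
  · exact hj.2 ((hreach h).symm.trans hends.symm)

theorem hasTwoWayEulerianPath_ladder_iff (h0 : 0 ∈ R) :
    HasTwoWayEulerianPath (ladder R) ↔ R.Infinite := by
  rw [hasTwoWayEulerianPath_iff (isLocallyFinite_ladder R)]
  refine ⟨fun h => ?_, hasExtendableTrails_ladder⟩
  by_contra hR
  exact not_hasExtendableTrails_ladder h0 (Set.not_infinite.1 hR) h

end Ladder

/-! ## Hardness -/

/-! ### Computable families of indices -/

section Indices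

open Nat.Partrec (Code)

lemma exists_computable_index {g : ℕ → ℕ → ℕ} (hg : Computable fun p : ℕ × ℕ => g p.1 p.2) :
    ∃ f : ℕ → ℕ, Computable f ∧ ∀ n x, phi (f n) x = Part.some (g n x) := by
  have h : Computable fun k : ℕ => g k.unpair.1 k.unpair.2 := hg.comp Computable.unpair
  obtain ⟨c, hc⟩ := Code.exists_code.1 (Partrec.nat_iff.1 h.partrec)
  refine ⟨fun n => Encodable.encode (Code.curry c n),
    Computable.encode.comp (Code.primrec₂_curry.to_comp.comp (Computable.const c) Computable.id),
    fun n x => ?_⟩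
  rw [phi, Denumerable.ofNat_encode, Code.eval_curry, hc]
  simp

lemma UniformlyHighlyComputable.exists_index {G : ℕ → Graph ℕ ℕ}
    (hG : UniformlyHighlyComputable G) :
    ∃ f : ℕ → ℕ, Computable f ∧ ∀ n, IsIndex (f n) (G n) := by
  classical
  obtain ⟨hlf, hV, hm, hd⟩ := hG
  rw [computablePred_iff_computable_decide] at hV
  obtain ⟨fV, hfV, hfV'⟩ := exists_computable_index
    (g := fun n v => if v ∈ (G n).vertexSet then 1 else 0)
    ((Computable.cond hV (Computable.const 1) (Computable.const 0)).of_eq fun p => by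
      by_cases h : p.2 ∈ (G p.1).vertexSet <;> simp [h])
  obtain ⟨fm, hfm, hfm'⟩ := exists_computable_index
    (g := fun n k => edgeMultiplicity (G n) k.unpair.1 k.unpair.2)
    (hm.comp (g := fun p : ℕ × ℕ => (p.1, p.2.unpair))
      (Computable.fst.pair (Computable.unpair.comp Computable.snd)))
  obtain ⟨fd, hfd, hfd'⟩ := exists_computable_index (g := fun n v => degree (G n) v) hd
  have hpair : Computable₂ Nat.pair := Primrec₂.natPair.to_comp
  refine ⟨fun n => Nat.pair (fV n) (Nat.pair (fm n) (fd n)),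
    hpair.comp hfV (hpair.comp hfm hfd), fun n => ⟨hlf n, fun v => ?_, fun u v => ?_, fun v => ?_⟩⟩
  · simp only [Nat.unpair_pair, hfV']
  · simp only [Nat.unpair_pair, hfm']
  · simp only [Nat.unpair_pair, hfd']

/-- Every `Π⁰₂` set is many-one reducible to the set of indices of total functions. -/
lemma IsPi02.reducible_total {X : Set ℕ} (hX : IsPi02 X) :
    ∃ f : ℕ → ℕ, Computable f ∧ ∀ x, x ∈ X ↔ ∀ y, (phi (f x) y).Dom := by
  classical
  obtain ⟨R, hR, h⟩ := hX
  rw [computablePred_iff_computable_decide] at hR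
  -- Search for a `z` that refutes `R x y z`; membership of `x` in `X` means that this succeeds for
  -- every `y`.
  have hp : Partrec fun k : ℕ =>
      Nat.rfind fun z => Part.some (! decide (R k.unpair.1 k.unpair.2 z)) := by
    refine Partrec.rfind (p := fun (k z : ℕ) =>
      Part.some (! decide (R k.unpair.1 k.unpair.2 z))) ?_
    have : Computable fun p : ℕ × ℕ => ! decide (R p.1.unpair.1 p.1.unpair.2 p.2) :=
      Primrec.not.to_comp.comp (hR.comp (g := fun p : ℕ × ℕ => (p.1.unpair.1, p.1.unpair.2, p.2))
        (Primrec.to_comp (by fun_prop)))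
    exact this.partrec
  obtain ⟨c, hc⟩ := Code.exists_code.1 (Partrec.nat_iff.1 hp)
  refine ⟨fun x => Encodable.encode (Code.curry c x),
    Computable.encode.comp (Code.primrec₂_curry.to_comp.comp (Computable.const c) Computable.id),
    fun x => ?_⟩
  rw [← not_iff_not, ← Set.mem_compl_iff, h]
  push Not
  refine exists_congr fun y => ?_
  have hdom : (Nat.rfind fun z => Part.some (! decide (R x y z))).Dom ↔ ∃ z, ¬ R x y z :=
    Nat.rfind_dom.trans ⟨fun ⟨z, hz, _⟩ => ⟨z, by simpa using hz⟩,
      fun ⟨z, hz⟩ => ⟨z, by simpa using hz, fun _ => trivial⟩⟩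
  rw [phi, Denumerable.ofNat_encode, Code.eval_curry, hc]
  simp only [Nat.unpair_pair]
  rw [hdom, not_exists_not]

end Indices

/-! ### Rungs that encode totality -/

section Rungs

open Nat.Partrec (Code)

/-- The computations of the program `e` on the inputs `0, …, y` halt within `k` steps. -/
def HaltsUpTo (e y k : ℕ) : Prop :=
  ∀ z < y + 1, (Code.evaln k (Denumerable.ofNat Code e) z).isSome = true

/-- A set that is infinite if and only if the program `e` is total: it contains `⟨y, k⟩` if `k` is
the least number of steps within which the computations on the inputs `0, …, y` halt. -/
def rungs (e : ℕ) : Set ℕ :=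
  -- The element `0` makes the ladder connected without affecting infinitude.
  {s | s = 0 ∨ (HaltsUpTo e s.unpair.1 s.unpair.2 ∧ ¬ HaltsUpTo e s.unpair.1 (s.unpair.2 - 1))}

lemma HaltsUpTo.mono {e y k l : ℕ} (h : HaltsUpTo e y k) (hkl : k ≤ l) : HaltsUpTo e y l := by
  intro z hz
  obtain ⟨x, hx⟩ := Option.isSome_iff_exists.1 (h z hz)
  exact Option.isSome_iff_exists.2 ⟨x, Code.evaln_mono hkl hx⟩

/-- Because `k - 1` is truncated, minimality of `k` can be expressed with it only for positive `k`;
this ensures that the least `k` is positive. -/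
lemma not_haltsUpTo_zero (e y : ℕ) : ¬ HaltsUpTo e y 0 := by
  intro h
  obtain ⟨x, hx⟩ := Option.isSome_iff_exists.1 (h 0 (by omega))
  exact absurd (Code.evaln_bound hx) (by omega)

lemma phi_dom_iff {e y : ℕ} :
    (phi e y).Dom ↔ ∃ k, (Code.evaln k (Denumerable.ofNat Code e) y).isSome = true := by
  simp only [Part.dom_iff_mem, phi, Code.evaln_complete, Option.isSome_iff_exists]
  exact exists_comm

lemma forall_dom_iff_exists_haltsUpTo (e y : ℕ) :
    (∀ z < y + 1, (phi e z).Dom) ↔ ∃ k, HaltsUpTo e y k := by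
  constructor
  · intro h
    have : ∀ z, ∃ k, z < y + 1 → (Code.evaln k (Denumerable.ofNat Code e) z).isSome = true := by
      intro z
      by_cases hz : z < y + 1
      · obtain ⟨k, hk⟩ := phi_dom_iff.1 (h z hz)
        exact ⟨k, fun _ => hk⟩
      · exact ⟨0, fun h => absurd h hz⟩
    choose k hk using this
    refine ⟨(Finset.range (y + 1)).sup k, fun z hz => ?_⟩
    obtain ⟨x, hx⟩ := Option.isSome_iff_exists.1 (hk z hz)
    exact Option.isSome_iff_exists.2
      ⟨x, Code.evaln_mono (Finset.le_sup (Finset.mem_range.2 hz)) hx⟩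
  · rintro ⟨k, hk⟩ z hz
    exact phi_dom_iff.2 ⟨k, hk z hz⟩

/-- Divergence at `y` rules out all first components from `y` on, and by minimality each first
component belongs to at most one nonzero element. For a total program every `y` contributes its
least `k`. -/
lemma infinite_rungs_iff (e : ℕ) : (rungs e).Infinite ↔ ∀ y, (phi e y).Dom := by
  classical
  constructor
  · intro hinf y
    by_contra hy
    have hlt : ∀ s : ℕ, HaltsUpTo e s.unpair.1 s.unpair.2 → s.unpair.1 < y := by
      intro s hs
      by_contra hsy
      exact hy ((forall_dom_iff_exists_haltsUpTo e _).2 ⟨_, hs⟩ y (by omega))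
    refine hinf (Set.Finite.insert 0 (s := {s : ℕ | HaltsUpTo e s.unpair.1 s.unpair.2 ∧
      ¬ HaltsUpTo e s.unpair.1 (s.unpair.2 - 1)}) ?_)
    refine Set.Finite.of_finite_image (f := fun s : ℕ => s.unpair.1)
      ((Set.finite_Iio y).subset ?_) ?_
    · rintro _ ⟨s, hs, rfl⟩
      exact hlt s hs.1
    · have hle : ∀ s s' : ℕ, HaltsUpTo e s.unpair.1 s.unpair.2 →
          ¬ HaltsUpTo e s'.unpair.1 (s'.unpair.2 - 1) → s.unpair.1 = s'.unpair.1 →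
          s'.unpair.2 ≤ s.unpair.2 := by
        intro s s' hs hs' h
        by_contra hlt
        rw [← h] at hs'
        exact hs' (hs.mono (by omega))
      intro s hs s' hs' h
      have h2 : s.unpair.2 = s'.unpair.2 :=
        le_antisymm (hle s' s hs'.1 hs.2 h.symm) (hle s s' hs.1 hs'.2 h)
      rw [← Nat.pair_unpair s, ← Nat.pair_unpair s']
      exact congrArg₂ Nat.pair h h2
  · intro h
    have hex : ∀ y, ∃ k, HaltsUpTo e y k := fun y =>
      (forall_dom_iff_exists_haltsUpTo e y).1 fun z _ => h z
    refine Set.infinite_of_injective_forall_mem (f := fun y => Nat.pair y (Nat.find (hex y)))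
      (fun y y' h => (Nat.pair_eq_pair.1 h).1) fun y => Or.inr ?_
    simp only [Nat.unpair_pair]
    refine ⟨Nat.find_spec (hex y), fun h' => ?_⟩
    have h1 := Nat.find_min' (hex y) h'
    have h2 : Nat.find (hex y) = 0 := by omega
    exact not_haltsUpTo_zero e y (h2 ▸ Nat.find_spec (hex y))

variable {α : Type} [Primcodable α]

lemma primrecPred_haltsUpTo {e y k : α → ℕ} (he : Primrec e) (hy : Primrec y) (hk : Primrec k) :
    PrimrecPred fun a => HaltsUpTo (e a) (y a) (k a) := by
  refine primrecPred_forall_lt (f := fun a => y a + 1) ?_ (by fun_prop)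
  refine Primrec.eq.comp (Primrec.option_isSome.comp (Code.primrec_evaln.comp
    (Primrec.pair (Primrec.pair (hk.comp Primrec.fst) ((Primrec.ofNat Code).comp
      (he.comp Primrec.fst))) Primrec.snd))) (Primrec.const true)

lemma primrecPred_mem_rungs {e s : α → ℕ} (he : Primrec e) (hs : Primrec s) :
    PrimrecPred fun a => s a ∈ rungs (e a) := by
  refine PrimrecPred.or (Primrec.eq.comp hs (Primrec.const 0)) (PrimrecPred.and
    (primrecPred_haltsUpTo he ?_ ?_) (PrimrecPred.not (primrecPred_haltsUpTo he ?_ ?_)))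
  · fun_prop
  · fun_prop
  · fun_prop
  · exact Primrec.nat_sub.comp (by fun_prop) (Primrec.const 1)

lemma primrec_ladderMult {e u v : α → ℕ} (he : Primrec e) (hu : Primrec u) (hv : Primrec v) :
    Primrec fun a => ladderMult (rungs (e a)) (u a) (v a) := by
  classical
  have h2 : ∀ {f : α → ℕ}, Primrec f → Primrec fun a => f a / 2 := fun hf =>
    Primrec.nat_div.comp hf (Primrec.const 2)
  refine Primrec.ite (PrimrecPred.or (Primrec.eq.comp hu ?_) (PrimrecPred.or
    (Primrec.eq.comp hv ?_) (PrimrecPred.and (PrimrecPred.not (Primrec.eq.comp hu hv))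
    (PrimrecPred.and (Primrec.eq.comp (h2 hu) (h2 hv)) (primrecPred_mem_rungs he (h2 hu))))))
    (Primrec.const 2) (Primrec.const 0)
  all_goals fun_prop

lemma primrec_sum_range {g : α → ℕ → ℕ} (hg : Primrec fun a : α × ℕ => g a.1 a.2) {f : α → ℕ}
    (hf : Primrec f) : Primrec fun a => ∑ i ∈ Finset.range (f a), g a i := by
  have h : Primrec₂ fun (a : α) (p : ℕ × ℕ) => p.2 + g a p.1 :=
    Primrec.nat_add.comp (Primrec.snd.comp Primrec.snd)
      (hg.comp (g := fun x : α × ℕ × ℕ => (x.1, x.2.1)) (by fun_prop))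
  refine (Primrec.nat_rec' hf (Primrec.const 0) h).of_eq fun a => ?_
  induction f a with
  | zero => rfl
  | succ n ih => rw [Finset.sum_range_succ, ← ih]

lemma uniformlyHighlyComputable_ladder :
    UniformlyHighlyComputable fun e => ladder (rungs e) := by
  refine ⟨fun e => isLocallyFinite_ladder _, ?_, ?_, ?_⟩
  · exact ⟨fun _ => .isTrue trivial, (Computable.const true).of_eq fun _ => rfl⟩
  · refine Primrec.to_comp ((primrec_ladderMult (e := fun p : ℕ × ℕ × ℕ => p.1)
      (u := fun p => p.2.1) (v := fun p => p.2.2) ?_ ?_ ?_).of_eq fun p => ?_)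
    · fun_prop
    · fun_prop
    · fun_prop
    · exact ((isMultiplicity_ladderMult _).edgeMultiplicity_eq _ _).symm
  · have hsum : Primrec fun p : ℕ × ℕ =>
        ∑ u ∈ Finset.range (p.2 + 3), ladderMult (rungs p.1) u p.2 := by
      refine primrec_sum_range (f := fun p : ℕ × ℕ => p.2 + 3)
        (primrec_ladderMult (e := fun a : (ℕ × ℕ) × ℕ => a.1.1)
        (u := fun a => a.2) (v := fun a => a.1.2) ?_ ?_ ?_) ?_
      all_goals fun_prop
    have hloop : Primrec fun p : ℕ × ℕ => ladderMult (rungs p.1) p.2 p.2 :=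
      primrec_ladderMult (by fun_prop) (by fun_prop) (by fun_prop)
    refine Primrec.to_comp ((Primrec.nat_add.comp hloop hsum).of_eq fun p => ?_)
    exact ((isMultiplicity_ladderMult _).degree_eq fun u hu => ladderMult_eq_zero_of_le hu).symm

lemma hasTwoWayEulerianPath_ladder_rungs_iff (e : ℕ) :
    HasTwoWayEulerianPath (ladder (rungs e)) ↔ ∀ y, (phi e y).Dom := by
  rw [hasTwoWayEulerianPath_ladder_iff (Or.inl rfl), infinite_rungs_iff]

/-- The multigraph that witnesses membership need not be the ladder itself. As the index determines
vertices and multiplicities, it is the ladder up to the names of edges, and its path can be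
transferred. -/
lemma mem_twoWayEulerianProblem_iff_of_isIndex_ladder {R : Set ℕ} (h0 : 0 ∈ R) {e : ℕ}
    (he : IsIndex e (ladder R)) :
    e ∈ TwoWayEulerianProblem ↔ HasTwoWayEulerianPath (ladder R) := by
  refine ⟨?_, fun h => ⟨_, he, connected_ladder h0, h⟩⟩
  rintro ⟨G, hG, -, hp⟩
  have hp' := hG.1.hasTwoWayEulerianPath_canonicalGraph hp
  have hV : G.vertexSet = Set.univ := by
    ext v
    rw [← hG.presents.vertIs_one_iff, he.presents.vertIs_one_iff]
    rfl
  have hm : edgeMultiplicity G = ladderMult R := by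
    ext u v
    rw [← (isMultiplicity_ladderMult R).edgeMultiplicity_eq]
    exact he.presents.multIs_iff.1 (hG.presents.multIs_iff.2 rfl)
  rwa [hV, hm] at hp'

end Rungs

end EulerPaths

theorem mainTheorem7 :
    EulerPaths.IsPi02Complete EulerPaths.TwoWayEulerianProblem ∧
    ∃ G : ℕ → Graph ℕ ℕ,
      EulerPaths.UniformlyHighlyComputable G ∧
      (∀ n, EulerPaths.Connected (G n) ∧ (G n).vertexSet.Infinite) ∧
      EulerPaths.IsPi02Complete {n | EulerPaths.HasTwoWayEulerianPath (G n)} := by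
  open EulerPaths in
  obtain ⟨f, hf, hfG⟩ := uniformlyHighlyComputable_ladder.exists_index
  have hiff : ∀ e, f e ∈ TwoWayEulerianProblem ↔ HasTwoWayEulerianPath (ladder (rungs e)) :=
    fun e => mem_twoWayEulerianProblem_iff_of_isIndex_ladder (Or.inl rfl) (hfG e)
  refine ⟨⟨isPi02_twoWayEulerianProblem, fun X hX => ?_⟩, fun e => ladder (rungs e),
    uniformlyHighlyComputable_ladder,
    fun e => ⟨connected_ladder (Or.inl rfl), Set.infinite_univ⟩, ?_, fun X hX => ?_⟩
  · obtain ⟨g, hg, h⟩ := hX.reducible_total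
    exact ⟨fun x => f (g x), hf.comp hg, fun x => (h x).trans
      ((hasTwoWayEulerianPath_ladder_rungs_iff _).symm.trans (hiff _).symm)⟩
  -- The upper bound is inherited from the index problem along the computable map `f`.
  · have : {n | HasTwoWayEulerianPath (ladder (rungs n))} = f ⁻¹' TwoWayEulerianProblem := by
      ext e
      exact (hiff e).symm
    rw [this]
    exact isPi02_twoWayEulerianProblem.preimage hf
  · obtain ⟨g, hg, h⟩ := hX.reducible_total
    exact ⟨g, hg, fun x => (h x).trans (hasTwoWayEulerianPath_ladder_rungs_iff _).symm⟩
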